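/- Let $N\ge 1$, let $\Omega\subset\mathbb R^N$ be open and $T>0$. Let $h:(0,\infty)\to(0,\infty)$ be continuous and integrable at $0$, let $P\in C[0,\infty)$ with $P(0)=0$ and $P(s)>0$ for $s>0$, and put $$H(s)=\int_0^s h(\sigma)\,d\sigma,\qquad F=hP\ \text{ on }(0,\infty),\quad F(0)=0,\qquad G(s)=\int_0^s\sqrt{F'(\sigma)}\,d\sigma,\quad G'=\sqrt{F'},$$ where it is assumed that $F(s)\to0$ as $s\to0^+$ and that $F$ is differentiable on $(0,\infty)$ with $F'>0$ and $F'$ locally bounded on $(0,\infty)$. Call $u\ge 0$ a nonnegative weak solution of $$[H(u)]_t-F(u)\,\Delta u\le 0\quad\text{in }\Omega\times(0,T]$$ if $u\in L^\infty_{loc}(\Omega\times[0,T])$; $u(\cdot,0)$ is continuous on $\Omega$ and $u(\cdot,t)\to u(\cdot,0)$ in measure on every compact subset of $\Omega$ as $t\to0^+$; the weak derivatives satisfy $u_t\in L^1_{loc}(\Omega\times(0,T])$ and $\nabla u\in L^2_{loc}(\Omega\times(0,T])$; the function $|\nabla G(u)|^2:=F'(u)|\nabla u|^2\mathbf 1_{\{u>0\}}$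 is in $L^1_{loc}(\Omega\times(0,T])$; and for all nonnegative $\theta\in Lip_c(\Omega)$ and nonnegative $\eta\in C_c^\infty((0,T))$, $$\int_0^T\!\!\int_\Omega\Big(-H(u)\,\theta\,\eta'+\big[F(u)\,\nabla u\cdot\nabla\theta+|\nabla G(u)|^2\,\theta\big]\,\eta\Big)\,dx\,dt\le 0 .$$ Let $u$ be such a solution, let $\Omega'\subset\Omega$ be open with $u(x,0)=0$ for all $x\in\Omega'$, and let $M>0$ be such that $u\le M$ a.e. in $\Omega'\times(0,T)$ and such that the following hold: (A-1) there is $C_1>0$ with $F(s)\le C_1\,G'(s)\,G(s)$ for $s\in[0,M]$ (both sides being $0$ at $s=0$); (A-2) there are $C_2>0$ and $0<\lambda<2$ with $\big(\sqrt{sF(s)}\big)^{\lambda}\le C_2\,H(s)$ for $s\in[0,M]$. Then for every ball with $\overline{B_R(x_0)}\subset\Omega'$ and every $R'\in(0,R)$ there is $T'\in(0,T]$ such that $u=0$ a.e. in $B_{R'}(x_0)\times[0,T']$. Moreover $u(\cdot,t)=0$ a.e. in $B_{R'}(x_0)$ for every $t\in[0,T']$ at which $s\mapsto u(\cdot,s)$,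 $s\in[0,T']$, is continuous with respect to convergence in measure on compact subsets of $\Omega$. -/

import Mathlib

open MeasureTheory Set Filter Topology Metric
open scoped ContDiff

noncomputable section

namespace Einstein

/-! ### Coefficients -/

/-- `H(s) = ∫₀ˢ h`. -/
def H (h : ℝ → ℝ) (s : ℝ) : ℝ := ∫ σ in (0 : ℝ)..s, h σ

/-- `F = h P`. -/
def F (h P : ℝ → ℝ) (s : ℝ) : ℝ := h s * P s

/-- `G' = √F'`. -/
def G' (h P : ℝ → ℝ) (s : ℝ) : ℝ := √(deriv (F h P) s)

/-- `G(s) = ∫₀ˢ √F'`. -/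
def G (h P : ℝ → ℝ) (s : ℝ) : ℝ := ∫ σ in (0 : ℝ)..s, G' h P σ

/-- The standing conditions on the coefficient functions `h` and `P`. -/
structure IsCoefficientPair (h P : ℝ → ℝ) : Prop where
  h_pos : ∀ s, 0 < s → 0 < h s
  h_cont : ContinuousOn h (Ioi 0)
  h_int : IntegrableOn h (Ioc 0 1)
  P_cont : ContinuousOn P (Ici 0)
  P_zero : P 0 = 0
  P_pos : ∀ s, 0 < s → 0 < P s
  /-- `F(0) = 0`, in the sense of the limit, since `h` need not be defined at `0`. -/
  F_zero : Tendsto (F h P) (𝓝[>] 0) (𝓝 0)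
  F_diff : ∀ s, 0 < s → DifferentiableAt ℝ (F h P) s
  F_deriv_pos : ∀ s, 0 < s → 0 < deriv (F h P) s
  F_deriv_locBdd : ∀ a b, 0 < a → ∃ C, ∀ s ∈ Icc a b, deriv (F h P) s ≤ C

/-- `F ≤ C₁ G' G` on `[0, M]`. At `s = 0` both sides vanish. -/
def AssumptionA1 (h P : ℝ → ℝ) (M : ℝ) : Prop :=
  ∃ C₁ > 0, ∀ s ∈ Icc 0 M, F h P s ≤ C₁ * (G' h P s * G h P s)

/-- `(√(s F(s))) ^ lam ≤ C₂ H(s)` on `[0, M]`, for some exponent `0 < lam < 2`. -/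
def AssumptionA2 (h P : ℝ → ℝ) (M : ℝ) : Prop :=
  ∃ C₂ > 0, ∃ lam : ℝ, 0 < lam ∧ lam < 2 ∧
    ∀ s ∈ Icc 0 M, (√(s * F h P s)) ^ lam ≤ C₂ * H h s

/-! ### Local spaces and weak derivatives -/

/-- `f ∈ L^p(K)` for every compact `K ⊆ S`. -/
def MemLpLoc {X E : Type*} [TopologicalSpace X] [MeasureSpace X] [NormedAddCommGroup E]
    (f : X → E) (p : ENNReal) (S : Set X) : Prop :=
  ∀ K ⊆ S, IsCompact K → MemLp f p (volume.restrict K)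

/-- `g` is the weak derivative of `f` in the direction `e` in the open set `U`. -/
def HasWeakDirDeriv {X : Type*} [NormedAddCommGroup X] [NormedSpace ℝ X] [MeasureSpace X]
    (U : Set X) (f g : X → ℝ) (e : X) : Prop :=
  ∀ φ : X → ℝ, ContDiff ℝ ∞ φ → HasCompactSupport φ → tsupport φ ⊆ U →
    ∫ z in U, f z * fderiv ℝ φ z e = -∫ z in U, g z * φ z

/-- Convergence in local measure on `Ω`: convergence in measure on every compact `K ⊆ Ω`. -/
def TendstoInLocalMeasure {X ι : Type*} [TopologicalSpace X] [MeasureSpace X]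
    (Ω : Set X) (f : ι → X → ℝ) (l : Filter ι) (g : X → ℝ) : Prop :=
  ∀ K ⊆ Ω, IsCompact K → TendstoInMeasure (volume.restrict K) f l g

/-! ### Solutions -/

variable {N : ℕ}

/-- `|∇G(u)|² = F'(u) |∇u|²`, with `Du = ∇u`. The factor `F'(u)` has a meaning only where `u > 0`;
the set `{u = 0}`, where `∇u = 0` almost everywhere, does not contribute. -/
def gradGSq (h P : ℝ → ℝ) (u : EuclideanSpace ℝ (Fin N) → ℝ → ℝ)
    (Du : EuclideanSpace ℝ (Fin N) × ℝ → EuclideanSpace ℝ (Fin N))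
    (z : EuclideanSpace ℝ (Fin N) × ℝ) : ℝ :=
  if 0 < u z.1 z.2 then deriv (F h P) (u z.1 z.2) * ‖Du z‖ ^ 2 else 0

/-- `u` is a nonnegative weak solution of `[H(u)]_t - F(u) Δu ≤ 0` in `Ω × (0, T]`, where
`-F(u) Δu` acts on `θ ∈ Lip_c(Ω)` as `∫ (F(u) ∇u · ∇θ + |∇G(u)|² θ) dx` and the time derivative is
taken in the sense of distributions on `(0, T)`. -/
structure IsWeakSolution (h P : ℝ → ℝ) (Ω : Set (EuclideanSpace ℝ (Fin N))) (T : ℝ)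
    (u : EuclideanSpace ℝ (Fin N) → ℝ → ℝ) : Prop where
  nonneg : ∀ x ∈ Ω, ∀ t ∈ Icc 0 T, 0 ≤ u x t
  /-- `u ∈ L^∞_loc(Ω × [0, T])`. -/
  locBdd : MemLpLoc (fun z : EuclideanSpace ℝ (Fin N) × ℝ => u z.1 z.2) ⊤ (Ω ×ˢ Icc 0 T)
  /-- The initial value is continuous. -/
  initial_cont : ContinuousOn (fun x => u x 0) Ω
  /-- `u(·, t) → u(·, 0)` in local measure as `t → 0+`. -/
  initial_trace : TendstoInLocalMeasure Ω (fun t x => u x t) (𝓝[>] 0) (fun x => u x 0)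
  /-- `u_t ∈ L¹_loc(Ω × (0, T])`. -/
  time_deriv : ∃ ut : EuclideanSpace ℝ (Fin N) × ℝ → ℝ,
    MemLpLoc ut 1 (Ω ×ˢ Ioc 0 T) ∧
    HasWeakDirDeriv (Ω ×ˢ Ioo 0 T) (fun z => u z.1 z.2) ut (0, 1)
  /-- `∇u ∈ L²_loc(Ω × (0, T])`, `|∇G(u)|² ∈ L¹_loc(Ω × (0, T])`, and the weak inequality. -/
  ineq : ∃ Du : EuclideanSpace ℝ (Fin N) × ℝ → EuclideanSpace ℝ (Fin N),
    MemLpLoc Du 2 (Ω ×ˢ Ioc 0 T) ∧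
    (∀ e : EuclideanSpace ℝ (Fin N),
      HasWeakDirDeriv (Ω ×ˢ Ioo 0 T) (fun z => u z.1 z.2) (fun z => inner ℝ (Du z) e) (e, 0)) ∧
    MemLpLoc (gradGSq h P u Du) 1 (Ω ×ˢ Ioc 0 T) ∧
    ∀ (θ : EuclideanSpace ℝ (Fin N) → ℝ) (η : ℝ → ℝ),
      (∃ K, LipschitzWith K θ) → HasCompactSupport θ → tsupport θ ⊆ Ω → (∀ x, 0 ≤ θ x) →
      ContDiff ℝ ∞ η → HasCompactSupport η → tsupport η ⊆ Ioo 0 T → (∀ t, 0 ≤ η t) →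
      ∫ z in Ω ×ˢ Ioo 0 T,
        (-(H h (u z.1 z.2) * θ z.1 * deriv η z.2)
          + (F h P (u z.1 z.2) * inner ℝ (Du z) (gradient θ z.1)
              + gradGSq h P u Du z * θ z.1) * η z.2) ≤ 0

end Einstein

end

/-!
# Finite speed of propagation for `[H(u)]_t - F(u) Δu ≤ 0`

The function `w = G(u)` is shown to vanish by a local energy method, which suffices
since `G(s) > 0` for `s > 0`.

Testing the inequality with `θ = ζ²`, for a cutoff `ζ`, the flux term is `2 F(u) ζ ∇u · ∇ζ`. Since
`F ≤ C₁ G' G`, it is at most `2 C₁ (G'(u) |∇u| ζ) (w |∇ζ|)`, and half of `|∇G(u)|² ζ²` absorbs it.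
As `u` vanishes initially, the essential supremum in time of `∫ H(u)` and the energy
`∬ |∇G(u)|²` over a small cylinder are both at most a constant times the slope squared of `ζ` times
`∬ w²` over a larger cylinder. By the Cauchy–Schwarz inequality `G(s) ≤ √(s F(s))`, so the second
assumption turns the bound for `∫ H(u)` into one for `∫ w^lam` (`energy_estimate`).

Conversely `∬ w²` is estimated by these two quantities. In place of the Gagliardo–Nirenberg
inequality an elementary argument is used (`interpolation`): for all `τ, r > 0` and `|y| < r`,
`w(x)² ≤ τ^(2 - lam) w(x)^lam + 4 |w(x + y) - w(x)|² + C τ^(-2 lam) w(x)^lam w(x + y)^lam`.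
After averaging over `y` the middle term is at most `4 r²` times the energy, the first one carries
the factor `τ^(2 - lam)`, which is small with `τ` because `lam < 2`, and the last one is quadratic in
the mass. The first and the last term also carry the length `T'` of the time interval.
On cylinders with radii decreasing to `R'` this gives, for `y n = ∬ w²`,
`y (n + 1) ≤ A 4ⁿ y n (r² + T' r⁻ᵏ 4ⁿ y n)` with a free `r ≲ 2⁻ⁿ`, and for small `T'` the sequence
tends to `0` (`exists_forall_tendsto_zero`).

The bound for `w(x + y) - w(x)` needs a chain rule for `G(u)`, although `F'` is merely locally
bounded away from `0`. On almost every line `u` is absolutely continuous, and there the inequality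
`(G(b) - G(a))² ≤ (b - a) (F(b) - F(a))` compares difference quotients of `G` with those of `F`,
which is differentiable everywhere (`sq_deriv_G_comp_le`, `ae_sq_G_translate_le`).
-/

noncomputable section

namespace Einstein

/-! ### The coefficient functions `F`, `G` and `H` -/

namespace IsCoefficientPair

variable {h P : ℝ → ℝ}

lemma F_at_zero (hP : IsCoefficientPair h P) : F h P 0 = 0 := by simp [F, hP.P_zero]

lemma F_pos (hP : IsCoefficientPair h P) {s : ℝ} (hs : 0 < s) : 0 < F h P s :=
  mul_pos (hP.h_pos s hs) (hP.P_pos s hs)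

lemma F_continuousOn (hP : IsCoefficientPair h P) : ContinuousOn (F h P) (Ici 0) := by
  intro s hs
  rcases eq_or_lt_of_le (mem_Ici.1 hs) with rfl | h0
  · rw [← Ioi_insert, continuousWithinAt_insert_self, ContinuousWithinAt, hP.F_at_zero]
    exact hP.F_zero
  · exact (hP.F_diff s h0).continuousAt.continuousWithinAt

lemma intervalIntegrable_deriv_F (hP : IsCoefficientPair h P) {a b : ℝ} (ha : 0 ≤ a)
    (hb : 0 ≤ b) : IntervalIntegrable (deriv (F h P)) volume a b := by
  have key : ∀ c, 0 ≤ c → IntervalIntegrable (deriv (F h P)) volume 0 c := fun c hc => by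
    rw [intervalIntegrable_iff_integrableOn_Ioc_of_le hc]
    exact intervalIntegral.integrableOn_deriv_of_nonneg
      (hP.F_continuousOn.mono Icc_subset_Ici_self)
      (fun x hx => (hP.F_diff x hx.1).hasDerivAt) (fun x hx => (hP.F_deriv_pos x hx.1).le)
  exact (key a ha).symm.trans (key b hb)

lemma integral_deriv_F (hP : IsCoefficientPair h P) {a b : ℝ} (ha : 0 ≤ a) (hab : a ≤ b) :
    ∫ σ in a..b, deriv (F h P) σ = F h P b - F h P a :=
  intervalIntegral.integral_eq_sub_of_hasDerivAt_of_le hab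
    (hP.F_continuousOn.mono fun _ hx => ha.trans hx.1)
    (fun x hx => (hP.F_diff x (ha.trans_lt hx.1)).hasDerivAt)
    (hP.intervalIntegrable_deriv_F ha (ha.trans hab))

lemma deriv_F_nonneg (hP : IsCoefficientPair h P) {s : ℝ} (hs : 0 < s) :
    0 ≤ deriv (F h P) s := (hP.F_deriv_pos s hs).le

lemma measurable_G' : Measurable (G' h P) := (measurable_deriv _).sqrt

lemma G'_sq (hP : IsCoefficientPair h P) {s : ℝ} (hs : 0 < s) :
    G' h P s ^ 2 = deriv (F h P) s := Real.sq_sqrt (hP.deriv_F_nonneg hs)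

lemma intervalIntegrable_G' (hP : IsCoefficientPair h P) {a b : ℝ} (ha : 0 ≤ a) (hb : 0 ≤ b) :
    IntervalIntegrable (G' h P) volume a b := by
  refine ((intervalIntegrable_const (c := (1 : ℝ))).add
    (hP.intervalIntegrable_deriv_F ha hb).norm).mono_fun
    measurable_G'.aestronglyMeasurable (ae_of_all _ fun s => ?_)
  change ‖√(deriv (F h P) s)‖ ≤ ‖1 + ‖deriv (F h P) s‖‖
  rw [Real.norm_of_nonneg (Real.sqrt_nonneg _), Real.norm_of_nonneg (by positivity)]
  refine (Real.sqrt_le_sqrt (le_abs_self _)).trans ?_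
  rw [Real.norm_eq_abs]
  nlinarith [Real.sq_sqrt (abs_nonneg (deriv (F h P) s)), sq_nonneg (√|deriv (F h P) s| - 1)]

lemma G_sub (hP : IsCoefficientPair h P) {a b : ℝ} (ha : 0 ≤ a) (hb : 0 ≤ b) :
    G h P b - G h P a = ∫ σ in a..b, G' h P σ :=
  intervalIntegral.integral_interval_sub_left (hP.intervalIntegrable_G' le_rfl hb)
    (hP.intervalIntegrable_G' le_rfl ha)

lemma G_at_zero : G h P 0 = 0 := by simp [G]

lemma G_mono (hP : IsCoefficientPair h P) : MonotoneOn (G h P) (Ici 0) := by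
  intro a ha b hb hab
  have := intervalIntegral.integral_nonneg (μ := volume) hab
    (fun σ _ => Real.sqrt_nonneg (deriv (F h P) σ))
  have h2 := hP.G_sub ha hb
  simp only [G'] at h2
  linarith

lemma G_nonneg (hP : IsCoefficientPair h P) {s : ℝ} (hs : 0 ≤ s) : 0 ≤ G h P s := by
  simpa [G_at_zero] using hP.G_mono (mem_Ici.2 le_rfl) (mem_Ici.2 hs) hs

/-- Since `G' = √F'`, the Cauchy–Schwarz inequality bounds the increments of `G` by those of `F`.
For `a = 0` this is `G(s) ≤ √(s F(s))`. -/
lemma G_sub_sq_le (hP : IsCoefficientPair h P) {a b : ℝ} (ha : 0 ≤ a) (hab : a ≤ b) :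
    (G h P b - G h P a) ^ 2 ≤ (b - a) * (F h P b - F h P a) := by
  rw [hP.G_sub ha (ha.trans hab), ← hP.integral_deriv_F ha hab]
  set A := ∫ σ in a..b, G' h P σ
  set B := ∫ σ in a..b, deriv (F h P) σ
  -- the discriminant of the nonnegative quadratic `c ↦ ∫ (G' - c)²`
  have key : ∀ c : ℝ, 0 ≤ B - 2 * c * A + c ^ 2 * (b - a) := by
    intro c
    have i1 := hP.intervalIntegrable_deriv_F ha (ha.trans hab)
    have i2 := (hP.intervalIntegrable_G' ha (ha.trans hab)).const_mul (2 * c)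
    have e : ∫ σ in a..b, (deriv (F h P) σ - 2 * c * G' h P σ + c ^ 2)
        = B - 2 * c * A + c ^ 2 * (b - a) := by
      rw [intervalIntegral.integral_add (i1.sub i2) intervalIntegrable_const,
        intervalIntegral.integral_sub i1 i2, intervalIntegral.integral_const_mul,
        intervalIntegral.integral_const, smul_eq_mul]
      ring
    rw [← e, intervalIntegral.integral_of_le hab]
    refine setIntegral_nonneg measurableSet_Ioc fun σ hσ => ?_
    rw [← hP.G'_sq (ha.trans_lt hσ.1)]
    nlinarith [sq_nonneg (G' h P σ - c)]
  rcases eq_or_lt_of_le hab with rfl | hlt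
  · simp [A]
  · have h1 := key (A / (b - a))
    have h2 : 0 < b - a := sub_pos.2 hlt
    have e : B - 2 * (A / (b - a)) * A + (A / (b - a)) ^ 2 * (b - a) = B - A ^ 2 / (b - a) := by
      field_simp
      ring
    rw [e, sub_nonneg, div_le_iff₀ h2] at h1
    linarith

lemma G_le_sqrt (hP : IsCoefficientPair h P) {s : ℝ} (hs : 0 ≤ s) :
    G h P s ≤ √(s * F h P s) := by
  apply Real.le_sqrt_of_sq_le
  simpa [G_at_zero, hP.F_at_zero] using hP.G_sub_sq_le le_rfl hs

lemma G_continuousOn (hP : IsCoefficientPair h P) : ContinuousOn (G h P) (Ici 0) := by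
  intro s hs
  have hb : ContinuousOn (G h P) (Icc 0 (s + 1)) := by
    have := intervalIntegral.continuousOn_primitive_interval (a := (0:ℝ)) (b := s + 1)
      (f := G' h P) (μ := volume) (by
        have hs' : (0:ℝ) ≤ s + 1 := by linarith [mem_Ici.1 hs]
        rw [uIcc_of_le hs', integrableOn_Icc_iff_integrableOn_Ioc,
          ← intervalIntegrable_iff_integrableOn_Ioc_of_le hs']
        exact hP.intervalIntegrable_G' le_rfl hs')
    rwa [uIcc_of_le (by linarith [mem_Ici.1 hs])] at this
  have := hb s ⟨hs, by linarith⟩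
  refine this.mono_of_mem_nhdsWithin ?_
  rw [mem_nhdsWithin]
  exact ⟨Iio (s + 1), isOpen_Iio, by simp, fun x hx => ⟨hx.2, hx.1.le⟩⟩

/-- Away from `0` the function `G` is Lipschitz, because `F'` is locally bounded there. -/
lemma G_max_lipschitzOn (hP : IsCoefficientPair h P) {δ M : ℝ} (hδ : 0 < δ) :
    ∃ K, LipschitzOnWith K (fun v => G h P (max v δ)) (Iic M) := by
  obtain ⟨C, hC⟩ := hP.F_deriv_locBdd δ (max M δ) hδ
  refine ⟨Real.toNNReal (√C), LipschitzOnWith.of_le_add_mul _ ?_⟩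
  intro x hx y hy
  rw [Real.coe_toNNReal _ (Real.sqrt_nonneg _)]
  have hx0 : 0 < max x δ := hδ.trans_le (le_max_right _ _)
  have hy0 : 0 < max y δ := hδ.trans_le (le_max_right _ _)
  rcases le_total x y with hxy | hxy
  · have := hP.G_mono (mem_Ici.2 hx0.le) (mem_Ici.2 hy0.le) (max_le_max_right δ hxy)
    have := mul_nonneg (Real.sqrt_nonneg C) (dist_nonneg (x := x) (y := y))
    linarith
  · have hm : max y δ ≤ max x δ := max_le_max_right δ hxy
    have h1 : G h P (max x δ) - G h P (max y δ) ≤ √C * (max x δ - max y δ) := by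
      rw [hP.G_sub hy0.le hx0.le]
      calc ∫ σ in (max y δ)..(max x δ), G' h P σ
          ≤ ∫ _σ in (max y δ)..(max x δ), √C := by
            refine intervalIntegral.integral_mono_on hm (hP.intervalIntegrable_G' hy0.le hx0.le)
              intervalIntegrable_const fun σ hσ => Real.sqrt_le_sqrt (hC σ ⟨?_, ?_⟩)
            · exact (le_max_right _ _).trans hσ.1
            · exact hσ.2.trans (max_le_max_right δ hx)
        _ = √C * (max x δ - max y δ) := by simp [mul_comm]
    have h2 : max x δ - max y δ ≤ dist x y := by
      rw [Real.dist_eq, abs_of_nonneg (sub_nonneg.2 hxy)]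
      rcases le_total x δ with h | h <;> rcases le_total y δ with h' | h' <;>
        simp [h, h'] <;> linarith
    have := mul_le_mul_of_nonneg_left h2 (Real.sqrt_nonneg C)
    linarith

lemma intervalIntegrable_h (hP : IsCoefficientPair h P) {a b : ℝ} (ha : 0 ≤ a) (hb : 0 ≤ b) :
    IntervalIntegrable h volume a b := by
  have key : ∀ c, 0 ≤ c → IntervalIntegrable h volume 0 c := fun c hc => by
    have h1 : IntervalIntegrable h volume 0 1 := by
      rw [intervalIntegrable_iff_integrableOn_Ioc_of_le zero_le_one]
      exact hP.h_int
    rcases le_total c 1 with h | h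
    · exact h1.mono_set (by rw [uIcc_of_le hc, uIcc_of_le zero_le_one]; exact Icc_subset_Icc_right h)
    · refine h1.trans (ContinuousOn.intervalIntegrable ?_)
      rw [uIcc_of_le h]
      exact hP.h_cont.mono fun x hx => zero_lt_one.trans_le hx.1
  exact (key a ha).symm.trans (key b hb)

lemma H_at_zero : H h 0 = 0 := by simp [H]

lemma H_mono (hP : IsCoefficientPair h P) : MonotoneOn (H h) (Ici 0) := by
  intro a ha b hb hab
  have h2 : H h b - H h a = ∫ σ in a..b, h σ :=
    intervalIntegral.integral_interval_sub_left (hP.intervalIntegrable_h le_rfl hb)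
      (hP.intervalIntegrable_h le_rfl ha)
  have h3 : 0 ≤ ∫ σ in a..b, h σ := by
    rw [intervalIntegral.integral_of_le hab]
    exact setIntegral_nonneg measurableSet_Ioc
      fun σ hσ => (hP.h_pos σ ((mem_Ici.1 ha).trans_lt hσ.1)).le
  linarith

lemma H_nonneg (hP : IsCoefficientPair h P) {s : ℝ} (hs : 0 ≤ s) : 0 ≤ H h s := by
  simpa [H_at_zero] using hP.H_mono (mem_Ici.2 le_rfl) (mem_Ici.2 hs) hs

lemma H_continuousOn (hP : IsCoefficientPair h P) {M : ℝ} (hM : 0 ≤ M) :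
    ContinuousOn (H h) (Icc 0 M) := by
  have := intervalIntegral.continuousOn_primitive_interval (a := (0:ℝ)) (b := M)
    (f := h) (μ := volume) (by
      rw [uIcc_of_le hM, integrableOn_Icc_iff_integrableOn_Ioc,
        ← intervalIntegrable_iff_integrableOn_Ioc_of_le hM]
      exact hP.intervalIntegrable_h le_rfl hM)
  rwa [uIcc_of_le hM] at this

end IsCoefficientPair

/-! ### A chain rule inequality for `G` along absolutely continuous curves -/

lemma sq_lintegral_le_lintegral_sq {α : Type*} [MeasurableSpace α] {μ : Measure α}
    [IsProbabilityMeasure μ] {f : α → ENNReal} (hf : AEMeasurable f μ) :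
    (∫⁻ a, f a ∂μ) ^ 2 ≤ ∫⁻ a, f a ^ 2 ∂μ := by
  have h := ENNReal.lintegral_mul_le_Lp_mul_Lq μ Real.HolderConjugate.two_two hf
    (aemeasurable_const (b := (1 : ENNReal)))
  simp only [Pi.mul_apply, mul_one, ENNReal.one_rpow, lintegral_const, measure_univ] at h
  calc (∫⁻ a, f a ∂μ) ^ 2 ≤ ((∫⁻ a, f a ^ (2:ℝ) ∂μ) ^ (1 / 2 : ℝ)) ^ 2 := by gcongr
    _ = ∫⁻ a, f a ^ 2 ∂μ := by
      rw [← ENNReal.rpow_natCast, ← ENNReal.rpow_mul]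
      simp

/-- The factor `F'(v)` of `|∇G(u)|²`, set to `0` at `v = 0`. -/
def derivF₀ (h P : ℝ → ℝ) (v : ℝ) : ℝ := if 0 < v then deriv (F h P) v else 0

lemma measurable_derivF₀ {h P : ℝ → ℝ} : Measurable (derivF₀ h P) :=
  Measurable.ite measurableSet_Ioi (measurable_deriv _) measurable_const

namespace IsCoefficientPair

variable {h P : ℝ → ℝ}

lemma derivF₀_nonneg (hP : IsCoefficientPair h P) (v : ℝ) : 0 ≤ derivF₀ h P v := by
  unfold derivF₀
  split_ifs with hv
  exacts [hP.deriv_F_nonneg hv, le_rfl]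

lemma F_mono (hP : IsCoefficientPair h P) : MonotoneOn (F h P) (Ici 0) := by
  intro a ha b hb hab
  have h1 := hP.integral_deriv_F ha hab
  have h2 : 0 ≤ ∫ σ in a..b, deriv (F h P) σ := by
    rw [intervalIntegral.integral_of_le hab]
    exact setIntegral_nonneg measurableSet_Ioc
      fun σ hσ => hP.deriv_F_nonneg ((mem_Ici.1 ha).trans_lt hσ.1)
  linarith

/-- The Cauchy–Schwarz bound for increments of `G`, for arguments in any order and for `G` cut off
below the level `δ`. -/
lemma G_max_sub_sq_le (hP : IsCoefficientPair h P) {δ : ℝ} (hδ : 0 < δ) {a b : ℝ} (ha : 0 ≤ a)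
    (hb : 0 ≤ b) :
    (G h P (max b δ) - G h P (max a δ)) ^ 2 ≤ (b - a) * (F h P b - F h P a) := by
  wlog hab : a ≤ b generalizing a b
  · have := this hb ha (le_of_not_ge hab)
    nlinarith
  have h0 := hP.G_sub_sq_le ha hab
  have h1 : G h P (max a δ) ≤ G h P (max b δ) :=
    hP.G_mono (mem_Ici.2 (hδ.le.trans (le_max_right _ _)))
      (mem_Ici.2 (hδ.le.trans (le_max_right _ _))) (max_le_max_right δ hab)
  have h2 : G h P (max b δ) - G h P (max a δ) ≤ G h P b - G h P a := by
    have h3 := hP.G_mono (mem_Ici.2 ha) (mem_Ici.2 hb) hab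
    rcases le_total b δ with hbδ | hbδ
    · rw [max_eq_right hbδ, max_eq_right (hab.trans hbδ)]
      linarith
    · rw [max_eq_left hbδ]
      have := hP.G_mono (mem_Ici.2 ha) (mem_Ici.2 (ha.trans (le_max_left _ _))) (le_max_left a δ)
      linarith
  nlinarith

/-- `G` need not be differentiable, nor `F'` continuous, at a given point. Still, wherever a curve
`g` and its image under the truncation of `G` have derivatives, the latter is at most
`√F'(g) |g'|`: the squared difference quotient of `G` is at most that of `F`. -/
lemma sq_deriv_G_comp_le (hP : IsCoefficientPair h P) {δ : ℝ} (hδ : 0 < δ) {g : ℝ → ℝ}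
    {s p q : ℝ} (hg0 : ∀ᶠ r in 𝓝 s, 0 ≤ g r) (hg : HasDerivAt g p s)
    (hk : HasDerivAt (fun r => G h P (max (g r) δ)) q s) :
    q ^ 2 ≤ derivF₀ h P (g s) * p ^ 2 := by
  rcases lt_or_ge (g s) δ with hlt | hge
  · have he : (fun r => G h P (max (g r) δ)) =ᶠ[𝓝 s] fun _ => G h P δ := by
      filter_upwards [hg.continuousAt.eventually (gt_mem_nhds hlt)] with r hr
      rw [max_eq_right hr.le]
    have hq : q = 0 := (hk.congr_of_eventuallyEq he.symm).unique (hasDerivAt_const s _)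
    rw [hq]
    have := mul_nonneg (hP.derivF₀_nonneg (g s)) (sq_nonneg p)
    simpa using this
  · have hpos : 0 < g s := hδ.trans_le hge
    have hF : HasDerivAt (fun r => F h P (g r)) (deriv (F h P) (g s) * p) s :=
      (hP.F_diff _ hpos).hasDerivAt.comp s hg
    rw [derivF₀, if_pos hpos]
    have l1 := (hasDerivAt_iff_tendsto_slope.1 hk).pow 2
    have l2 := (hasDerivAt_iff_tendsto_slope.1 hg).mul (hasDerivAt_iff_tendsto_slope.1 hF)
    have := le_of_tendsto_of_tendsto l1 l2 (by
      filter_upwards [hg0.filter_mono nhdsWithin_le_nhds, self_mem_nhdsWithin] with r hr hrs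
      have h1 := hP.G_max_sub_sq_le hδ hpos.le hr
      have h2 : r - s ≠ 0 := sub_ne_zero.2 hrs
      simp only [slope_def_field]
      rw [div_pow, div_mul_div_comm, ← sq]
      exact div_le_div_of_nonneg_right h1 (sq_nonneg _))
    nlinarith

/-- Along an absolutely continuous curve `g = c + ∫ p` in `[0, M]` the increment of `G` is
controlled by `∫ F'(g) |g'|²`. -/
lemma sq_G_increment_le (hP : IsCoefficientPair h P) {M c : ℝ} {p : ℝ → ℝ}
    (hp : IntervalIntegrable p volume 0 1)
    (hg : ∀ s ∈ Icc (0 : ℝ) 1, c + ∫ r in (0:ℝ)..s, p r ∈ Icc 0 M) :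
    ENNReal.ofReal ((G h P (c + ∫ r in (0:ℝ)..1, p r) - G h P c) ^ 2) ≤
      ∫⁻ s in Ioc (0:ℝ) 1,
        ENNReal.ofReal (derivF₀ h P (c + ∫ r in (0:ℝ)..s, p r) * p s ^ 2) := by
  set g : ℝ → ℝ := fun s => c + ∫ r in (0:ℝ)..s, p r with hgdef
  have hg0 : g 0 = c := by simp [g]
  have hc : c ∈ Icc 0 M := by simpa [g] using hg 0 (by simp)
  have hgac : AbsolutelyContinuousOnInterval g 0 1 := by
    have hcst : AbsolutelyContinuousOnInterval (fun _ : ℝ => c) 0 1 :=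
      ((LipschitzWith.const c).lipschitzOnWith (s := uIcc 0 1)).absolutelyContinuousOnInterval
    exact hcst.add (hp.absolutelyContinuousOnInterval_intervalIntegral (c := 0) (by simp))
  suffices H : ∀ δ > 0, ENNReal.ofReal ((G h P (max (g 1) δ) - G h P (max (g 0) δ)) ^ 2) ≤
      ∫⁻ s in Ioc (0:ℝ) 1, ENNReal.ofReal (derivF₀ h P (g s) * p s ^ 2) by
    have hlim : ∀ v, 0 ≤ v → Tendsto (fun δ => G h P (max v δ)) (𝓝[>] 0) (𝓝 (G h P v)) := by
      intro v hv
      have h1 : Tendsto (fun δ : ℝ => max v δ) (𝓝[>] 0) (𝓝[Ici 0] v) := by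
        refine tendsto_nhdsWithin_iff.2
          ⟨?_, Eventually.of_forall fun δ => mem_Ici.2 (hv.trans (le_max_left _ _))⟩
        have : Tendsto (fun δ : ℝ => max v δ) (𝓝 0) (𝓝 (max v 0)) :=
          (continuous_const.max continuous_id).tendsto 0
        rw [max_eq_left hv] at this
        exact this.mono_left nhdsWithin_le_nhds
      exact Tendsto.comp (hP.G_continuousOn v hv) h1
    rw [show G h P c = G h P (g 0) by rw [hg0]]
    refine le_of_tendsto (ENNReal.tendsto_ofReal
      (((hlim _ (hg 1 (by simp)).1).sub (hlim _ (hg 0 (by simp)).1)).pow 2)) ?_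
    filter_upwards [self_mem_nhdsWithin] with δ hδ using H δ hδ
  intro δ hδ
  obtain ⟨K, hK⟩ := hP.G_max_lipschitzOn (M := M) hδ
  set k : ℝ → ℝ := fun r => G h P (max (g r) δ) with hk
  have hkac : AbsolutelyContinuousOnInterval k 0 1 := by
    rw [absolutelyContinuousOnInterval_iff] at hgac ⊢
    intro ε hε
    obtain ⟨η, hη, H⟩ := hgac (ε / (K + 1)) (by positivity)
    refine ⟨η, hη, fun E hE hlen => ?_⟩
    have h1 := H E hE hlen
    have hmem : ∀ i ∈ Finset.range E.1,
        g (E.2 i).1 ∈ Iic M ∧ g (E.2 i).2 ∈ Iic M := by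
      intro i hi
      have := hE.1 i hi
      rw [uIcc_of_le zero_le_one] at this
      exact ⟨(hg _ this.1).2, (hg _ this.2).2⟩
    calc ∑ i ∈ Finset.range E.1, dist (k (E.2 i).1) (k (E.2 i).2)
        ≤ ∑ i ∈ Finset.range E.1, (K + 1) * dist (g (E.2 i).1) (g (E.2 i).2) := by
          refine Finset.sum_le_sum fun i hi => ?_
          have := hK.dist_le_mul _ (hmem i hi).1 _ (hmem i hi).2
          have h3 := dist_nonneg (x := g (E.2 i).1) (y := g (E.2 i).2)
          simp only [hk]
          linarith
      _ = (K + 1) * ∑ i ∈ Finset.range E.1, dist (g (E.2 i).1) (g (E.2 i).2) := by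
          rw [Finset.mul_sum]
      _ < (K + 1) * (ε / (K + 1)) := by gcongr
      _ = ε := by field_simp
  have hftc := hkac.integral_deriv_eq_sub
  have hae : ∀ᵐ s ∂(volume.restrict (Ioc (0:ℝ) 1)),
      deriv k s ^ 2 ≤ derivF₀ h P (g s) * p s ^ 2 := by
    rw [ae_restrict_iff' measurableSet_Ioc]
    have hne : ∀ᵐ s : ℝ, s ≠ 1 := by simp [ae_iff, measure_singleton]
    filter_upwards [hkac.ae_differentiableAt, hp.ae_hasDerivAt_integral, hne] with s h1 h2 h3 hs
    have hsI : s ∈ uIcc (0:ℝ) 1 := by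
      rw [uIcc_of_le zero_le_one]; exact ⟨hs.1.le, hs.2⟩
    refine hP.sq_deriv_G_comp_le hδ ?_ ((h2 hsI 0 (by simp)).const_add c) (h1 hsI).hasDerivAt
    filter_upwards [Ioo_mem_nhds hs.1 (lt_of_le_of_ne hs.2 h3)] with r hr
    exact (hg r ⟨hr.1.le, hr.2.le⟩).1
  have : IsProbabilityMeasure (volume.restrict (Ioc (0:ℝ) 1)) := ⟨by simp⟩
  calc ENNReal.ofReal ((k 1 - k 0) ^ 2) = ‖∫ s in Ioc (0:ℝ) 1, deriv k s‖ₑ ^ 2 := by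
        rw [← intervalIntegral.integral_of_le zero_le_one, hftc, Real.enorm_eq_ofReal_abs,
          ← ENNReal.ofReal_pow (abs_nonneg _), sq_abs]
    _ ≤ (∫⁻ s in Ioc (0:ℝ) 1, ‖deriv k s‖ₑ) ^ 2 := by
        gcongr
        exact enorm_integral_le_lintegral_enorm _
    _ ≤ ∫⁻ s in Ioc (0:ℝ) 1, ‖deriv k s‖ₑ ^ 2 :=
        sq_lintegral_le_lintegral_sq (measurable_deriv k).enorm.aemeasurable
    _ ≤ _ := by
        refine lintegral_mono_ae ?_
        filter_upwards [hae] with s hs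
        rw [Real.enorm_eq_ofReal_abs, ← ENNReal.ofReal_pow (abs_nonneg _), sq_abs]
        exact ENNReal.ofReal_le_ofReal hs

end IsCoefficientPair

/-! ### Weak directional derivatives and translations -/

section Translation

variable {X : Type*} [NormedAddCommGroup X] [NormedSpace ℝ X] [FiniteDimensional ℝ X]
  [MeasureSpace X] [BorelSpace X] [(volume : Measure X).IsAddHaarMeasure]

lemma integrable_prod_translate {q : X → ℝ} (hqm : Measurable q) (hq : Integrable q) (e : X)
    (s : ℝ) :
    Integrable (fun a : X × ℝ => q (a.1 + a.2 • e))
      ((volume : Measure X).prod (volume.restrict (Ioc 0 s))) := by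
  have hm : Measurable fun a : X × ℝ => q (a.1 + a.2 • e) :=
    hqm.comp (measurable_fst.add (measurable_snd.smul_const e))
  refine (integrable_prod_iff' hm.aestronglyMeasurable).2
    ⟨ae_of_all _ fun τ => hq.comp_add_right (τ • e), ?_⟩
  have : (fun τ : ℝ => ∫ z : X, ‖q (z + τ • e)‖) = fun _ => ∫ z, ‖q z‖ := by
    funext τ
    exact integral_add_right_eq_self (fun z => ‖q z‖) (τ • e)
  rw [this]
  exact integrable_const _

/-- A bounded function with integrable weak derivative `p` in the direction `e` is, along almost
every line parallel to `e`, the integral of `p`. -/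
lemma ae_translate_sub_eq_integral {v p : X → ℝ} (hvm : Measurable v) {M : ℝ}
    (hvM : ∀ z, ‖v z‖ ≤ M) (hpm : Measurable p) (hp : Integrable p) {V : Set X} (hV : IsOpen V)
    (e : X)
    (hw : ∀ τ ∈ Icc (0:ℝ) 1, ∀ φ : X → ℝ, ContDiff ℝ ∞ φ → HasCompactSupport φ → tsupport φ ⊆ V →
      ∫ z, v z * fderiv ℝ φ (z - τ • e) e = -∫ z, p z * φ (z - τ • e))
    {s : ℝ} (hs : s ∈ Icc (0:ℝ) 1) :
    ∀ᵐ z, z ∈ V → v (z + s • e) = v z + ∫ τ in (0:ℝ)..s, p (z + τ • e) := by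
  have hvl : LocallyIntegrable v :=
    (memLp_top_of_bound hvm.aestronglyMeasurable M (ae_of_all _ hvM)).locallyIntegrable le_top
  have hvl' : LocallyIntegrable fun z => v (z + s • e) :=
    (memLp_top_of_bound (hvm.comp (measurable_add_const _)).aestronglyMeasurable M
      (ae_of_all _ fun z => hvM _)).locallyIntegrable le_top
  have hpp := integrable_prod_translate hpm hp e s
  have hpi : Integrable fun z => ∫ τ in Ioc (0:ℝ) s, p (z + τ • e) := hpp.integral_prod_left
  have main := hV.ae_eq_zero_of_integral_contDiff_smul_eq_zero
    (f := fun z => v (z + s • e) - v z - ∫ τ in Ioc (0:ℝ) s, p (z + τ • e))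
    (((hvl'.sub hvl).sub hpi.locallyIntegrable).locallyIntegrableOn V) ?_
  · filter_upwards [main] with z hz hzV
    rw [intervalIntegral.integral_of_le hs.1]
    linarith [hz hzV]
  intro φ hφ hφc hφV
  have hφi : ∀ x : X, Integrable fun z => φ (z - x) := fun x =>
    ((hφ.continuous.integrable_of_hasCompactSupport hφc).comp_sub_right x)
  have iv : ∀ x : X, Integrable fun z => v z * φ (z - x) := fun x =>
    (hφi x).bdd_mul hvm.aestronglyMeasurable (ae_of_all _ hvM)
  have e1 : ∫ z, φ z * v (z + s • e) = ∫ z, v z * φ (z - s • e) := by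
    rw [← integral_add_right_eq_self (fun z => v z * φ (z - s • e)) (s • e)]
    simp only [add_sub_cancel_right, mul_comm]
  have i1 : Integrable fun z => φ z * v (z + s • e) := by
    have := (iv (s • e)).comp_add_right (s • e)
    simpa only [add_sub_cancel_right, mul_comm] using this
  have i2 : Integrable fun z => φ z * v z := by simpa [mul_comm] using iv 0
  -- the fundamental theorem of calculus for the test function
  have hq : Continuous fun z => fderiv ℝ φ z e :=
    (hφ.continuous_fderiv (by simp)).clm_apply continuous_const
  have hqc : HasCompactSupport fun z => fderiv ℝ φ z e := hφc.fderiv_apply (𝕜 := ℝ) e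
  have ftc : ∀ z, φ (z - s • e) - φ z = -∫ τ in Ioc (0:ℝ) s, fderiv ℝ φ (z - τ • e) e := by
    intro z
    have hd : ∀ τ ∈ uIcc (0:ℝ) s,
        HasDerivAt (fun τ : ℝ => φ (z - τ • e)) (-(fderiv ℝ φ (z - τ • e) e)) τ := by
      intro τ _
      have h1 : HasDerivAt (fun τ : ℝ => z - τ • e) (-e) τ := by
        simpa using ((hasDerivAt_id τ).smul_const e).const_sub z
      rw [← map_neg]
      exact ((hφ.differentiable (by simp)) (z - τ • e)).hasFDerivAt.comp_hasDerivAt τ h1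
    have hc : Continuous fun τ : ℝ => -(fderiv ℝ φ (z - τ • e) e) :=
      (hq.comp (continuous_const.sub (continuous_id.smul continuous_const))).neg
    have := intervalIntegral.integral_eq_sub_of_hasDerivAt hd (hc.intervalIntegrable 0 s)
    rw [intervalIntegral.integral_of_le hs.1, integral_neg] at this
    simpa using this.symm
  have e2 : (∫ z, v z * φ (z - s • e)) - ∫ z, φ z * v z
      = ∫ z, φ z * ∫ τ in Ioc (0:ℝ) s, p (z + τ • e) := by
    have hFub : Integrable (fun a : X × ℝ => v a.1 * fderiv ℝ φ (a.1 - a.2 • e) e)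
        ((volume : Measure X).prod (volume.restrict (Ioc 0 s))) := by
      have := integrable_prod_translate hq.measurable (hq.integrable_of_hasCompactSupport hqc)
        (-e) s
      simp only [smul_neg, ← sub_eq_add_neg] at this
      exact this.bdd_mul (hvm.comp measurable_fst).aestronglyMeasurable
        (ae_of_all _ fun a => hvM a.1)
    have hFub2 : Integrable (fun a : X × ℝ => φ a.1 * p (a.1 + a.2 • e))
        ((volume : Measure X).prod (volume.restrict (Ioc 0 s))) := by
      obtain ⟨C, hC⟩ := hφ.continuous.bounded_above_of_compact_support hφc
      exact hpp.bdd_mul (hφ.continuous.measurable.comp measurable_fst).aestronglyMeasurable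
        (ae_of_all _ fun a => hC a.1)
    calc (∫ z, v z * φ (z - s • e)) - ∫ z, φ z * v z
        = ∫ z, -∫ τ in Ioc (0:ℝ) s, v z * fderiv ℝ φ (z - τ • e) e := by
          rw [← integral_sub (iv _) i2]
          congr 1 with z
          rw [integral_const_mul, ← mul_neg, ← ftc z]
          ring
      _ = -∫ τ in Ioc (0:ℝ) s, ∫ z, v z * fderiv ℝ φ (z - τ • e) e := by
          rw [integral_neg, integral_integral_swap hFub]
      _ = ∫ τ in Ioc (0:ℝ) s, ∫ z, φ z * p (z + τ • e) := by
          rw [← integral_neg]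
          refine setIntegral_congr_fun measurableSet_Ioc fun τ hτ => ?_
          rw [hw τ ⟨hτ.1.le, hτ.2.trans hs.2⟩ φ hφ hφc hφV, neg_neg,
            ← integral_add_right_eq_self (fun z => p z * φ (z - τ • e)) (τ • e)]
          simp only [add_sub_cancel_right, mul_comm]
      _ = ∫ z, φ z * ∫ τ in Ioc (0:ℝ) s, p (z + τ • e) := by
          rw [← integral_integral_swap hFub2]
          simp only [integral_const_mul]
  have i3 : Integrable fun z => φ z * ∫ τ in Ioc (0:ℝ) s, p (z + τ • e) := by
    obtain ⟨C, hC⟩ := hφ.continuous.bounded_above_of_compact_support hφc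
    exact hpi.bdd_mul hφ.continuous.aestronglyMeasurable (ae_of_all _ hC)
  have : ∀ z, φ z • (v (z + s • e) - v z - ∫ τ in Ioc (0:ℝ) s, p (z + τ • e))
      = φ z * v (z + s • e) - φ z * v z - φ z * ∫ τ in Ioc (0:ℝ) s, p (z + τ • e) := by
    intro z
    rw [smul_eq_mul]
    ring
  simp only [this]
  have i12 : Integrable fun z => φ z * v (z + s • e) - φ z * v z := i1.sub i2
  rw [integral_sub i12 i3, integral_sub i1 i2, e1, e2, sub_self]

end Translation

/-! ### Borel representatives of bounded solutions and the translation estimate -/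

/-- `v` is a Borel function on space-time with values in `[0, M]` which on `S × (0, T)` is a weak
solution with zero initial values and with Borel spatial gradient `D`. Since all test functions
are supported in `S × (0, T)`, the integrals are taken over the whole space. The integrands
involve `F'(v)|D|²` in the form `derivF₀ h P (v z) * ‖D z‖ ^ 2`. -/
structure IsBorelSolution {N : ℕ} (h P : ℝ → ℝ) (S : Set (EuclideanSpace ℝ (Fin N))) (T M : ℝ)
    (v : EuclideanSpace ℝ (Fin N) × ℝ → ℝ)
    (D : EuclideanSpace ℝ (Fin N) × ℝ → EuclideanSpace ℝ (Fin N)) : Prop where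
  measurable_v : Measurable v
  mem_Icc : ∀ z, v z ∈ Icc 0 M
  measurable_D : Measurable D
  integrableOn_D : ∀ K ⊆ S ×ˢ Ioo 0 T, IsCompact K → IntegrableOn D K
  integrableOn_energy : ∀ K ⊆ S ×ˢ Ioo 0 T, IsCompact K →
    IntegrableOn (fun z => derivF₀ h P (v z) * ‖D z‖ ^ 2) K
  weak_gradient : ∀ (y : EuclideanSpace ℝ (Fin N)) (φ : EuclideanSpace ℝ (Fin N) × ℝ → ℝ),
    ContDiff ℝ ∞ φ → HasCompactSupport φ → tsupport φ ⊆ S ×ˢ Ioo 0 T →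
    ∫ z, v z * fderiv ℝ φ z (y, 0) = -∫ z, inner ℝ (D z) y * φ z
  weak_ineq : ∀ (θ : EuclideanSpace ℝ (Fin N) → ℝ) (η : ℝ → ℝ),
    (∃ K, LipschitzWith K θ) → HasCompactSupport θ → tsupport θ ⊆ S → (∀ x, 0 ≤ θ x) →
    ContDiff ℝ ∞ η → HasCompactSupport η → tsupport η ⊆ Ioo 0 T → (∀ t, 0 ≤ η t) →
    ∫ z : EuclideanSpace ℝ (Fin N) × ℝ, (-(H h (v z) * θ z.1 * deriv η z.2)
      + (F h P (v z) * inner ℝ (D z) (gradient θ z.1)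
        + derivF₀ h P (v z) * ‖D z‖ ^ 2 * θ z.1) * η z.2) ≤ 0
  initial : ∀ K ⊆ S, IsCompact K → ∀ ε > 0, ∃ s₀ > 0, ∀ᵐ s ∂(volume.restrict (Ioo 0 s₀)),
    volume {x ∈ K | ε ≤ v (x, s)} ≤ ENNReal.ofReal ε

instance {N : ℕ} :
    (volume : Measure (EuclideanSpace ℝ (Fin N) × ℝ)).IsAddHaarMeasure :=
  Measure.prod.instIsAddHaarMeasure _ _

lemma measurable_comp_of_continuousOn {α : Type*} [MeasurableSpace α] {f : ℝ → ℝ} {v : α → ℝ}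
    {M : ℝ} (hf : ContinuousOn f (Icc 0 M)) (hv : Measurable v) (hvM : ∀ z, v z ∈ Icc 0 M) :
    Measurable fun z => f (v z) := by
  rcases isEmpty_or_nonempty α with hα | ⟨⟨z₀⟩⟩
  · exact measurable_of_empty _
  have hM : (0:ℝ) ≤ M := (hvM z₀).1.trans (hvM z₀).2
  have h1 : Continuous (IccExtend hM ((Icc 0 M).domRestrict f)) := hf.domRestrict.Icc_extend'
  convert h1.measurable.comp hv using 1
  funext z
  rw [Function.comp_apply, IccExtend_of_mem hM _ (hvM z)]
  rfl

namespace IsBorelSolution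

variable {N : ℕ} {h P : ℝ → ℝ} {S : Set (EuclideanSpace ℝ (Fin N))} {T M : ℝ}
  {v : EuclideanSpace ℝ (Fin N) × ℝ → ℝ}
  {D : EuclideanSpace ℝ (Fin N) × ℝ → EuclideanSpace ℝ (Fin N)}

lemma translate_mem {x₀ y : EuclideanSpace ℝ (Fin N)} {ρ r a b τ : ℝ} (hy : ‖y‖ ≤ r)
    (hτ : τ ∈ Icc (0:ℝ) 1) {z : EuclideanSpace ℝ (Fin N) × ℝ} (hz : z ∈ ball x₀ ρ ×ˢ Ioo a b) :
    z + τ • (y, (0:ℝ)) ∈ ball x₀ (ρ + r) ×ˢ Ioo a b := by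
  obtain ⟨x, t⟩ := z
  have h2 : ‖τ • y‖ ≤ r := by
    rw [norm_smul, Real.norm_of_nonneg hτ.1]
    nlinarith [norm_nonneg y, hτ.2]
  have h1 : dist (x + τ • y) x ≤ r := by simpa [dist_eq_norm] using h2
  have h3 := mem_ball.1 hz.1
  have h4 := dist_triangle (x + τ • y) x x₀
  refine ⟨?_, ?_⟩
  · simp only [Prod.fst_add, Prod.smul_fst, mem_ball] at h3 ⊢
    linarith
  · simpa using hz.2

/-- On almost every line in a spatial direction `y` the solution is absolutely continuous, and the
chain rule inequality bounds the increment of `G(v)` over the translation by `y`. -/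
lemma ae_sq_G_translate_le (hS : IsBorelSolution h P S T M v D) (hP : IsCoefficientPair h P)
    {x₀ y : EuclideanSpace ℝ (Fin N)} {ρ r a b : ℝ} (ha : 0 < a) (hb : b < T)
    (hρ : closedBall x₀ (ρ + r) ⊆ S) (hy : ‖y‖ ≤ r) :
    ∀ᵐ z, z ∈ ball x₀ ρ ×ˢ Ioo a b →
      ENNReal.ofReal ((G h P (v (z + (y, 0))) - G h P (v z)) ^ 2) ≤
        ∫⁻ τ in Ioc (0:ℝ) 1, ENNReal.ofReal (‖y‖ ^ 2 *
          (derivF₀ h P (v (z + τ • (y, (0:ℝ)))) * ‖D (z + τ • (y, (0:ℝ)))‖ ^ 2)) := by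
  set e : EuclideanSpace ℝ (Fin N) × ℝ := (y, 0) with he
  set V := ball x₀ ρ ×ˢ Ioo a b with hVdef
  set K := closedBall x₀ (ρ + r) ×ˢ Icc a b with hKdef
  have hKc : IsCompact K := (isCompact_closedBall _ _).prod isCompact_Icc
  have hKU : K ⊆ S ×ˢ Ioo 0 T := prod_mono hρ fun t ht => ⟨ha.trans_le ht.1, ht.2.trans_lt hb⟩
  have hKm : MeasurableSet K := hKc.isClosed.measurableSet
  have hVo : IsOpen V := isOpen_ball.prod isOpen_Ioo
  have hVK : ∀ τ ∈ Icc (0:ℝ) 1, ∀ z ∈ V, z + τ • e ∈ K := fun τ hτ z hz =>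
    prod_mono ball_subset_closedBall Ioo_subset_Icc_self (translate_mem hy hτ hz)
  set p : EuclideanSpace ℝ (Fin N) × ℝ → ℝ := K.indicator fun z => inner ℝ (D z) y with hp
  have hpm : Measurable p := (hS.measurable_D.inner_const).indicator hKm
  have hpi : Integrable p :=
    (integrable_indicator_iff hKm).2 ((hS.integrableOn_D K hKU hKc).inner_const y)
  have hvM : ∀ z, ‖v z‖ ≤ M := fun z => by
    rw [Real.norm_of_nonneg (hS.mem_Icc z).1]
    exact (hS.mem_Icc z).2
  have hw : ∀ τ ∈ Icc (0:ℝ) 1, ∀ φ : EuclideanSpace ℝ (Fin N) × ℝ → ℝ, ContDiff ℝ ∞ φ →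
      HasCompactSupport φ → tsupport φ ⊆ V →
      ∫ z, v z * fderiv ℝ φ (z - τ • e) e = -∫ z, p z * φ (z - τ • e) := by
    intro τ hτ φ hφ hφc hφV
    have hsupp : Function.support (fun z => φ (z - τ • e)) ⊆ K := by
      intro z hz
      have : z - τ • e ∈ V := hφV (subset_tsupport _ hz)
      simpa using hVK τ hτ _ this
    have hts : tsupport (fun z => φ (z - τ • e)) ⊆ K := closure_minimal hsupp hKc.isClosed
    have := hS.weak_gradient y (fun z => φ (z - τ • e))
      (hφ.comp (contDiff_id.sub contDiff_const))
      (HasCompactSupport.of_support_subset_isCompact hKc hsupp) (hts.trans hKU)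
    simp only [fderiv_comp_sub (f := φ)] at this
    rw [this]
    congr 2 with z
    by_cases hz : z ∈ K
    · simp [hp, hz]
    · rw [Function.notMem_support.1 fun hh => hz (hsupp hh)]
      simp
  have hall := fun s hs =>
    ae_translate_sub_eq_integral hS.measurable_v hvM hpm hpi hVo e hw (s := s) hs
  have hcut : ∀ z, ∀ s ∈ Ioc (0:ℝ) 1, ∫ τ in (0:ℝ)..s, p (z + τ • e)
      = ∫ τ in Ioc (0:ℝ) 1, if τ ≤ s then p (z + τ • e) else 0 := by
    intro z s hs
    have e1 : (fun τ : ℝ => if τ ≤ s then p (z + τ • e) else 0)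
        = (Iic s).indicator fun τ => p (z + τ • e) := by
      funext τ
      simp [indicator_apply]
    rw [e1, setIntegral_indicator measurableSet_Iic, Ioc_inter_Iic, min_eq_right hs.2,
      intervalIntegral.integral_of_le hs.1.le]
  -- for almost every base point, the representation holds at almost every parameter
  have hfub : ∀ᵐ z, ∀ᵐ s ∂(volume.restrict (Ioc (0:ℝ) 1)),
      z ∈ V → v (z + s • e) = v z + ∫ τ in Ioc (0:ℝ) 1, if τ ≤ s then p (z + τ • e) else 0 := by
    rw [Measure.ae_ae_comm]
    · rw [ae_restrict_iff' measurableSet_Ioc]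
      refine ae_of_all _ fun s hs => ?_
      filter_upwards [hall s ⟨hs.1.le, hs.2⟩] with z hz hzV
      rw [hz hzV, hcut z s hs]
    · have m1 : Measurable fun x : (EuclideanSpace ℝ (Fin N) × ℝ) × ℝ => v (x.1 + x.2 • e) :=
        hS.measurable_v.comp (measurable_fst.add (measurable_snd.smul_const e))
      have m2 : Measurable fun x : (EuclideanSpace ℝ (Fin N) × ℝ) × ℝ =>
          ∫ τ in Ioc (0:ℝ) 1, if τ ≤ x.2 then p (x.1 + τ • e) else 0 := by
        refine (StronglyMeasurable.integral_prod_right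
          (f := fun (x : (EuclideanSpace ℝ (Fin N) × ℝ) × ℝ) (τ : ℝ) =>
            if τ ≤ x.2 then p (x.1 + τ • e) else 0) ?_).measurable
        refine Measurable.stronglyMeasurable (Measurable.ite ?_ ?_ measurable_const)
        · exact measurableSet_le measurable_snd (measurable_snd.comp measurable_fst)
        · exact hpm.comp ((measurable_fst.comp measurable_fst).add (measurable_snd.smul_const e))
      have m3 := (measurable_fst (hVo.measurableSet.compl)).union (measurableSet_eq_fun m1
        ((hS.measurable_v.comp measurable_fst).add m2))
      convert m3 using 1
      ext x
      simp [imp_iff_not_or]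
  filter_upwards [hfub, hall 1 (by simp), (integrable_prod_translate hpm hpi e 1).prod_right_ae]
    with z hz1 hz2 hz3 hzV
  have hpz : IntervalIntegrable (fun τ => p (z + τ • e)) volume 0 1 :=
    (intervalIntegrable_iff_integrableOn_Ioc_of_le zero_le_one).2 hz3
  set g : ℝ → ℝ := fun s => v z + ∫ τ in (0:ℝ)..s, p (z + τ • e) with hg
  have hvg : ∀ᵐ s ∂(volume.restrict (Ioc (0:ℝ) 1)), v (z + s • e) = g s := by
    filter_upwards [hz1, ae_restrict_mem measurableSet_Ioc] with s hs hs01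
    rw [hs hzV, ← hcut z s hs01]
  have hgc : ContinuousOn g (Icc 0 1) := by
    have := intervalIntegral.continuousOn_primitive_interval (a := (0:ℝ)) (b := 1)
      (f := fun τ => p (z + τ • e)) (μ := volume) (by
        rw [uIcc_of_le zero_le_one, integrableOn_Icc_iff_integrableOn_Ioc]
        exact hz3)
    rw [uIcc_of_le zero_le_one] at this
    exact continuousOn_const.add this
  have hgM : ∀ s ∈ Icc (0:ℝ) 1, g s ∈ Icc 0 M := by
    have := Measure.eqOn_Icc_of_ae_eq (volume : Measure ℝ) (zero_ne_one)
      (f := g) (g := fun s => max 0 (min M (g s))) (by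
        rw [← Measure.restrict_congr_set Ioc_ae_eq_Icc]
        filter_upwards [hvg] with s hs
        have := hS.mem_Icc (z + s • e)
        rw [hs] at this
        rw [min_eq_right this.2, max_eq_right this.1]) hgc
      (continuousOn_const.sup (continuousOn_const.inf hgc))
    intro s hs
    have hM0 : 0 ≤ M := (hS.mem_Icc z).1.trans (hS.mem_Icc z).2
    rw [this hs]
    exact ⟨le_max_left _ _, max_le hM0 (min_le_left _ _)⟩
  have h1 : v (z + e) = g 1 := by simpa using hz2 hzV
  rw [h1]
  refine (hP.sq_G_increment_le hpz hgM).trans (lintegral_mono_ae ?_)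
  filter_upwards [hvg, ae_restrict_mem measurableSet_Ioc] with s hs hs01
  refine ENNReal.ofReal_le_ofReal ?_
  change derivF₀ h P (g s) * _ ≤ _
  rw [← hs, hp, indicator_of_mem (hVK s ⟨hs01.1.le, hs01.2⟩ z hzV)]
  have h2 := abs_real_inner_le_norm (D (z + s • e)) y
  have h3 : inner ℝ (D (z + s • e)) y ^ 2 ≤ (‖D (z + s • e)‖ * ‖y‖) ^ 2 := by
    rw [← sq_abs]
    gcongr
  calc derivF₀ h P (v (z + s • e)) * inner ℝ (D (z + s • e)) y ^ 2
      ≤ derivF₀ h P (v (z + s • e)) * (‖D (z + s • e)‖ * ‖y‖) ^ 2 :=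
        mul_le_mul_of_nonneg_left h3 (hP.derivF₀_nonneg _)
    _ = _ := by ring

lemma measurable_G_comp (hP : IsCoefficientPair h P) (hv : Measurable v)
    (hvM : ∀ z, v z ∈ Icc 0 M) : Measurable fun z => G h P (v z) :=
  measurable_comp_of_continuousOn
    (hP.G_continuousOn.mono fun _ hx => hx.1) hv hvM

/-- Translating `G(v)` in space by `y` moves it in `L²` by at most `‖y‖` times the `L²` norm of
`∇G(v)`. -/
lemma lintegral_sq_G_translate_le (hS : IsBorelSolution h P S T M v D)
    (hP : IsCoefficientPair h P) {x₀ y : EuclideanSpace ℝ (Fin N)} {ρ r T' : ℝ} (hT' : T' ≤ T)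
    (hρ : closedBall x₀ (ρ + r) ⊆ S) (hy : ‖y‖ ≤ r) :
    ∫⁻ z in ball x₀ ρ ×ˢ Ioo 0 T',
        ENNReal.ofReal ((G h P (v (z + (y, 0))) - G h P (v z)) ^ 2) ≤
      ENNReal.ofReal (r ^ 2) * ∫⁻ z in ball x₀ (ρ + r) ×ˢ Ioo 0 T',
        ENNReal.ofReal (derivF₀ h P (v z) * ‖D z‖ ^ 2) := by
  set W := ball x₀ (ρ + r) ×ˢ Ioo 0 T' with hW
  have hWm : MeasurableSet W := (isOpen_ball.prod isOpen_Ioo).measurableSet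
  have hVm : MeasurableSet (ball x₀ ρ ×ˢ Ioo 0 T') :=
    (isOpen_ball.prod isOpen_Ioo).measurableSet
  set f : EuclideanSpace ℝ (Fin N) × ℝ → ENNReal := fun z =>
    ENNReal.ofReal (‖y‖ ^ 2 * (derivF₀ h P (v z) * ‖D z‖ ^ 2)) with hf
  have hfm : Measurable f := ENNReal.measurable_ofReal.comp
    (((measurable_derivF₀.comp hS.measurable_v).mul (hS.measurable_D.norm.pow_const 2)).const_mul _)
  have hae : ∀ᵐ z ∂(volume.restrict (ball x₀ ρ ×ˢ Ioo 0 T')),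
      ENNReal.ofReal ((G h P (v (z + (y, 0))) - G h P (v z)) ^ 2) ≤
        ∫⁻ τ in Ioc (0:ℝ) 1, f (z + τ • (y, (0:ℝ))) := by
    rw [ae_restrict_iff' hVm]
    have := ae_all_iff.2 fun n : ℕ => hS.ae_sq_G_translate_le hP (x₀ := x₀) (y := y) (ρ := ρ)
      (r := r) (a := 1 / ((n:ℝ) + 1)) (b := T' - 1 / ((n:ℝ) + 1)) (by positivity)
      (by have : 0 < 1 / ((n:ℝ) + 1) := by positivity
          linarith) hρ hy
    filter_upwards [this] with z hz hzV
    obtain ⟨n, hn⟩ := exists_nat_one_div_lt (lt_min hzV.2.1 (sub_pos.2 hzV.2.2))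
    refine hz n ⟨hzV.1, (hn.trans_le (min_le_left _ _)), ?_⟩
    have := hn.trans_le (min_le_right _ _)
    linarith
  calc _ ≤ ∫⁻ z in ball x₀ ρ ×ˢ Ioo 0 T', ∫⁻ τ in Ioc (0:ℝ) 1, f (z + τ • (y, (0:ℝ))) :=
        lintegral_mono_ae hae
    _ = ∫⁻ τ in Ioc (0:ℝ) 1, ∫⁻ z in ball x₀ ρ ×ˢ Ioo 0 T', f (z + τ • (y, (0:ℝ))) :=
        lintegral_lintegral_swap (hfm.comp
          (measurable_fst.add (measurable_snd.smul_const (y, (0:ℝ))))).aemeasurable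
    _ ≤ ∫⁻ _τ in Ioc (0:ℝ) 1, ∫⁻ z in W, f z := by
        refine setLIntegral_mono measurable_const fun τ hτ => ?_
        rw [← lintegral_indicator hVm, ← lintegral_indicator hWm,
          ← lintegral_add_right_eq_self (W.indicator f) (τ • (y, (0:ℝ)))]
        refine lintegral_mono fun z => ?_
        by_cases hz : z ∈ ball x₀ ρ ×ˢ Ioo 0 T'
        · rw [indicator_of_mem hz,
            indicator_of_mem (translate_mem hy ⟨hτ.1.le, hτ.2⟩ hz)]
        · rw [indicator_of_notMem hz]
          exact zero_le
    _ = ∫⁻ z in W, f z := by simp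
    _ = ENNReal.ofReal (‖y‖ ^ 2) * ∫⁻ z in W,
          ENNReal.ofReal (derivF₀ h P (v z) * ‖D z‖ ^ 2) := by
        simp only [hf, ENNReal.ofReal_mul (sq_nonneg ‖y‖)]
        rw [lintegral_const_mul' _ _ ENNReal.ofReal_ne_top]
    _ ≤ _ := by gcongr

end IsBorelSolution

/-! ### Testing in time -/

/-- The primitive of a normalised bump: a smooth step from `0` to `1`. -/
def smoothStep (φ : ContDiffBump (0:ℝ)) (τ : ℝ) : ℝ :=
  ∫ σ in (-φ.rOut)..τ, φ.normed volume σ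

section SmoothStep

variable (φ : ContDiffBump (0:ℝ))

lemma hasDerivAt_smoothStep (τ : ℝ) : HasDerivAt (smoothStep φ) (φ.normed volume τ) τ :=
  intervalIntegral.integral_hasDerivAt_right (φ.continuous_normed.intervalIntegrable _ _)
    (φ.continuous_normed.stronglyMeasurableAtFilter _ _) φ.continuous_normed.continuousAt

lemma contDiff_smoothStep : ContDiff ℝ ∞ (smoothStep φ) := by
  rw [contDiff_infty_iff_deriv]
  refine ⟨fun τ => (hasDerivAt_smoothStep φ τ).differentiableAt, ?_⟩
  rw [show deriv (smoothStep φ) = φ.normed volume from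
    funext fun τ => (hasDerivAt_smoothStep φ τ).deriv]
  exact φ.contDiff_normed

lemma normed_eq_zero {σ : ℝ} (hσ : φ.rOut ≤ |σ|) : φ.normed volume σ = 0 := by
  rw [← Function.notMem_support, φ.support_normed_eq]
  simpa using hσ

lemma smoothStep_of_le {τ : ℝ} (hτ : τ ≤ -φ.rOut) : smoothStep φ τ = 0 := by
  rw [smoothStep, intervalIntegral.integral_symm, neg_eq_zero]
  refine (intervalIntegral.integral_congr (g := fun _ => (0:ℝ)) fun σ hσ => ?_).trans (by simp)
  rw [uIcc_of_le hτ] at hσ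
  refine normed_eq_zero φ ?_
  have := neg_le_abs σ
  linarith [hσ.2]

lemma smoothStep_of_ge {τ : ℝ} (hτ : φ.rOut ≤ τ) : smoothStep φ τ = 1 := by
  have h0 := φ.rOut_pos
  rw [smoothStep, intervalIntegral.integral_of_le (by linarith),
    ← φ.integral_normed (μ := volume)]
  refine setIntegral_eq_integral_of_forall_compl_eq_zero fun σ hσ => normed_eq_zero φ ?_
  by_contra hc
  rw [not_le, abs_lt] at hc
  exact hσ ⟨hc.1, hc.2.le.trans hτ⟩

lemma smoothStep_mono : Monotone (smoothStep φ) :=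
  monotone_of_deriv_nonneg (fun τ => (hasDerivAt_smoothStep φ τ).differentiableAt) fun τ => by
    rw [(hasDerivAt_smoothStep φ τ).deriv]
    exact φ.nonneg_normed τ

lemma smoothStep_nonneg (τ : ℝ) : 0 ≤ smoothStep φ τ := by
  rcases le_total τ (-φ.rOut) with h | h
  · exact (smoothStep_of_le φ h).ge
  · exact (smoothStep_of_le φ le_rfl).ge.trans (smoothStep_mono φ h)

lemma smoothStep_le_one (τ : ℝ) : smoothStep φ τ ≤ 1 := by
  rcases le_total φ.rOut τ with h | h
  · exact (smoothStep_of_ge φ h).le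
  · exact (smoothStep_mono φ h).trans (smoothStep_of_ge φ le_rfl).le

end SmoothStep

section Time

variable {T T' Q : ℝ} {m g q : ℝ → ℝ}

/-- The differential inequality `m' + g ≤ q` with `m(0+) = 0`, tested with the difference of a step
near `0` and a step at `t`, bounds both a local average of `m` near `t` and the integral of `g` up
to `t`. -/
lemma average_add_integral_le (hT' : T' ≤ T)
    (hm : Measurable m) {B : ℝ} (hmB : ∀ t, |m t| ≤ B)
    (hg0 : ∀ t, 0 ≤ g t) (hgi : ∀ a b, 0 < a → b < T → IntegrableOn g (Icc a b))
    (hq0 : ∀ t, 0 ≤ q t) (hqi : IntegrableOn q (Ioo 0 T'))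
    (hineq : ∀ η : ℝ → ℝ, ContDiff ℝ ∞ η → HasCompactSupport η → tsupport η ⊆ Ioo 0 T →
      (∀ t, 0 ≤ η t) → ∫ t, g t * η t ≤ (∫ t, m t * deriv η t) + ∫ t, q t * η t)
    (hinit : ∀ ε > 0, ∃ s₀ > 0, ∀ᵐ s ∂(volume.restrict (Ioo 0 s₀)), m s ≤ ε)
    (φ : ContDiffBump (0:ℝ)) {a t : ℝ} (ha : 0 < a) (hat : φ.rOut < t) (htT : t + φ.rOut < T') :
    (∫ τ, m τ * φ.normed volume (τ - t)) + ∫ τ in Ioo a (t - φ.rOut), g τ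
      ≤ ∫ τ in Ioo 0 T', q τ := by
  have hr := φ.rOut_pos
  refine le_of_forall_pos_le_add fun ε hε => ?_
  obtain ⟨s₀, hs₀, hms⟩ := hinit ε hε
  obtain ⟨κ, hκ0, hκ⟩ : ∃ κ, 0 < κ ∧ 3 * κ < min s₀ (min a (t - φ.rOut)) := by
    have : 0 < min s₀ (min a (t - φ.rOut)) := lt_min hs₀ (lt_min ha (by linarith))
    exact ⟨min s₀ (min a (t - φ.rOut)) / 4, by linarith, by linarith⟩
  obtain ⟨hκ1, hκ'⟩ := lt_min_iff.1 hκ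
  obtain ⟨hκ2, hκ3⟩ := lt_min_iff.1 hκ'
  let φ₁ : ContDiffBump (0:ℝ) := ⟨κ / 2, κ, by linarith, by linarith⟩
  have hφ₁ : φ₁.rOut = κ := rfl
  set η : ℝ → ℝ := fun τ => smoothStep φ₁ (τ - 2 * κ) - smoothStep φ (τ - t) with hη
  have hη0 : ∀ τ, 0 ≤ η τ := by
    intro τ
    rcases le_total (3 * κ) τ with h | h
    · have h1 : smoothStep φ₁ (τ - 2 * κ) = 1 := smoothStep_of_ge φ₁ (by rw [hφ₁]; linarith)
      simp only [hη, h1]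
      linarith [smoothStep_le_one φ (τ - t)]
    · have h1 : smoothStep φ (τ - t) = 0 := smoothStep_of_le φ (by linarith)
      simp only [hη, h1]
      linarith [smoothStep_nonneg φ₁ (τ - 2 * κ)]
  have hη1 : ∀ τ, η τ ≤ 1 := fun τ => by
    simp only [hη]
    linarith [smoothStep_le_one φ₁ (τ - 2 * κ), smoothStep_nonneg φ (τ - t)]
  have hη_one : ∀ τ ∈ Ioo a (t - φ.rOut), η τ = 1 := by
    intro τ hτ
    have h1 : smoothStep φ₁ (τ - 2 * κ) = 1 :=
      smoothStep_of_ge φ₁ (by rw [hφ₁]; linarith [hτ.1])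
    have h2 : smoothStep φ (τ - t) = 0 := smoothStep_of_le φ (by linarith [hτ.2])
    simp [hη, h1, h2]
  have hsupp : Function.support η ⊆ Icc κ (t + φ.rOut) := by
    intro τ hτ
    by_contra hc
    rw [mem_Icc, not_and_or, not_le, not_le] at hc
    apply hτ
    rcases hc with hc | hc
    · have h1 : smoothStep φ₁ (τ - 2 * κ) = 0 := smoothStep_of_le φ₁ (by rw [hφ₁]; linarith)
      have h2 : smoothStep φ (τ - t) = 0 := smoothStep_of_le φ (by linarith)
      simp [hη, h1, h2]
    · have h1 : smoothStep φ₁ (τ - 2 * κ) = 1 :=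
        smoothStep_of_ge φ₁ (by rw [hφ₁]; linarith)
      have h2 : smoothStep φ (τ - t) = 1 := smoothStep_of_ge φ (by linarith)
      simp [hη, h1, h2]
  have hηs : ContDiff ℝ ∞ η :=
    ((contDiff_smoothStep φ₁).comp (contDiff_id.sub contDiff_const)).sub
      ((contDiff_smoothStep φ).comp (contDiff_id.sub contDiff_const))
  have hηc : HasCompactSupport η :=
    HasCompactSupport.of_support_subset_isCompact isCompact_Icc hsupp
  have hηT : tsupport η ⊆ Ioo 0 T := (closure_minimal hsupp isClosed_Icc).trans
    fun τ hτ => ⟨hκ0.trans_le hτ.1, by linarith [hτ.2]⟩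
  have hderiv : ∀ τ, deriv η τ = φ₁.normed volume (τ - 2 * κ) - φ.normed volume (τ - t) :=
    fun τ => (((hasDerivAt_smoothStep φ₁ (τ - 2 * κ)).comp_sub_const τ (2 * κ)).sub
      ((hasDerivAt_smoothStep φ (τ - t)).comp_sub_const τ t)).deriv
  have main := hineq η hηs hηc hηT hη0
  have im : ∀ (ψ : ContDiffBump (0:ℝ)) (c : ℝ),
      Integrable fun τ => m τ * ψ.normed volume (τ - c) := fun ψ c =>
    ((ψ.integrable_normed).comp_sub_right c).bdd_mul hm.aestronglyMeasurable (ae_of_all _ hmB)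
  have e1 : ∫ τ, m τ * deriv η τ = (∫ τ, m τ * φ₁.normed volume (τ - 2 * κ))
      - ∫ τ, m τ * φ.normed volume (τ - t) := by
    rw [← integral_sub (im _ _) (im _ _)]
    congr 1 with τ
    rw [hderiv]
    ring
  have b1 : ∫ τ, m τ * φ₁.normed volume (τ - 2 * κ) ≤ ε := by
    have e2 : ∫ τ, ε * φ₁.normed volume (τ - 2 * κ) = ε := by
      rw [integral_const_mul, integral_sub_right_eq_self (fun τ => φ₁.normed volume τ) (2 * κ),
        φ₁.integral_normed, mul_one]
    rw [← e2]
    refine integral_mono_ae (im _ _) ((φ₁.integrable_normed.comp_sub_right _).const_mul ε) ?_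
    rw [ae_restrict_iff' measurableSet_Ioo] at hms
    filter_upwards [hms] with τ hτ
    by_cases h : τ ∈ Ioo 0 s₀
    · exact mul_le_mul_of_nonneg_right (hτ h) (φ₁.nonneg_normed _)
    · have : φ₁.normed volume (τ - 2 * κ) = 0 := by
        refine normed_eq_zero φ₁ ?_
        by_contra hc
        rw [not_le, hφ₁, abs_lt] at hc
        exact h ⟨by linarith [hc.1], by linarith [hc.2]⟩
      simp [this]
  have b2 : ∫ τ, q τ * η τ ≤ ∫ τ in Ioo 0 T', q τ := by
    rw [← integral_indicator measurableSet_Ioo]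
    refine integral_mono_of_nonneg (ae_of_all _ fun τ => mul_nonneg (hq0 τ) (hη0 τ))
      ((integrable_indicator_iff measurableSet_Ioo).2 hqi) (ae_of_all _ fun τ => ?_)
    by_cases h : τ ∈ Ioo 0 T'
    · rw [indicator_of_mem h]
      exact mul_le_of_le_one_right (hq0 τ) (hη1 τ)
    · rw [indicator_of_notMem h]
      have : η τ = 0 := by
        by_contra hc
        have := hsupp hc
        exact h ⟨hκ0.trans_le this.1, this.2.trans_lt htT⟩
      simp [this]
  have b3 : ∫ τ in Ioo a (t - φ.rOut), g τ ≤ ∫ τ, g τ * η τ := by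
    have i1 : Integrable fun τ => g τ * η τ := by
      have : IntegrableOn (fun τ => g τ * η τ) (Icc κ (t + φ.rOut)) :=
        (hgi κ (t + φ.rOut) hκ0 (by linarith)).mul_bdd hηs.continuous.aestronglyMeasurable
          (ae_of_all _ fun τ => by
            rw [Real.norm_of_nonneg (hη0 τ)]
            exact hη1 τ)
      refine (integrableOn_iff_integrable_of_support_subset fun τ hτ => hsupp ?_).1 this
      exact fun hc => hτ (by simp [hc])
    rw [show ∫ τ in Ioo a (t - φ.rOut), g τ = ∫ τ in Ioo a (t - φ.rOut), g τ * η τ from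
      setIntegral_congr_fun measurableSet_Ioo fun τ hτ => by simp [hη_one τ hτ]]
    exact setIntegral_le_integral i1 (ae_of_all _ fun τ => mul_nonneg (hg0 τ) (hη0 τ))
  linarith

/-- The differential inequality `m' + g ≤ q` in the sense of distributions, with nonnegative terms
and `m(0+) = 0`, bounds `m` almost everywhere and `∫ g` by `∫ q`. -/
lemma ae_le_and_integral_le (hT' : T' ≤ T)
    (hm : Measurable m) {B : ℝ} (hmB : ∀ t, |m t| ≤ B) (hm0 : ∀ t, 0 ≤ m t)
    (hg0 : ∀ t, 0 ≤ g t) (hgi : ∀ a b, 0 < a → b < T → IntegrableOn g (Icc a b))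
    (hq0 : ∀ t, 0 ≤ q t) (hqi : IntegrableOn q (Ioo 0 T'))
    (hineq : ∀ η : ℝ → ℝ, ContDiff ℝ ∞ η → HasCompactSupport η → tsupport η ⊆ Ioo 0 T →
      (∀ t, 0 ≤ η t) → ∫ t, g t * η t ≤ (∫ t, m t * deriv η t) + ∫ t, q t * η t)
    (hinit : ∀ ε > 0, ∃ s₀ > 0, ∀ᵐ s ∂(volume.restrict (Ioo 0 s₀)), m s ≤ ε) :
    (∀ᵐ t ∂(volume.restrict (Ioo 0 T')), m t ≤ ∫ τ in Ioo 0 T', q τ) ∧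
      ∀ a b, 0 < a → a < b → b < T' → ∫ τ in Ioo a b, g τ ≤ ∫ τ in Ioo 0 T', q τ := by
  constructor
  · let φ : ℕ → ContDiffBump (0:ℝ) := fun n =>
      ⟨1 / ((n:ℝ) + 1) / 2, 1 / ((n:ℝ) + 1), by positivity, half_lt_self (by positivity)⟩
    have hφ : Tendsto (fun n => (φ n).rOut) atTop (𝓝 0) := tendsto_one_div_add_atTop_nhds_zero_nat
    have hml : LocallyIntegrable m :=
      (memLp_top_of_bound hm.aestronglyMeasurable B (ae_of_all _ hmB)).locallyIntegrable le_top
    have hconv := ContDiffBump.ae_convolution_tendsto_right_of_locallyIntegrable (μ := volume)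
      (K := 2) hφ (Eventually.of_forall fun n => by
        change 1 / ((n:ℝ) + 1) ≤ 2 * (1 / ((n:ℝ) + 1) / 2)
        linarith) hml
    rw [ae_restrict_iff' measurableSet_Ioo]
    filter_upwards [hconv] with t ht htT
    refine le_of_tendsto ht ?_
    filter_upwards [hφ.eventually (gt_mem_nhds htT.1),
      hφ.eventually (gt_mem_nhds (sub_pos.2 htT.2))] with n hn1 hn2
    have key := average_add_integral_le hT' hm hmB hg0 hgi hq0 hqi hineq hinit (φ n)
      (a := t) htT.1 hn1 (by linarith)
    have hempty : Ioo t (t - (φ n).rOut) = ∅ := Ioo_eq_empty (by linarith [(φ n).rOut_pos])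
    rw [hempty, setIntegral_empty, add_zero] at key
    refine le_of_eq_of_le ?_ key
    rw [convolution_def, ← integral_sub_left_eq_self _ volume t]
    congr 1 with τ
    have : (φ n).normed volume (t - τ) = (φ n).normed volume (τ - t) := by
      rw [← (φ n).normed_neg, neg_sub]
    simp [this, mul_comm]
  · intro a b ha hab hbT
    let φ : ContDiffBump (0:ℝ) := ⟨(T' - b) / 8, (T' - b) / 4, by linarith, by linarith⟩
    have hφ : φ.rOut = (T' - b) / 4 := rfl
    have key := average_add_integral_le hT' hm hmB hg0 hgi hq0 hqi hineq hinit φ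
      (a := a) (t := b + (T' - b) / 4) ha (by rw [hφ]; linarith) (by rw [hφ]; linarith)
    rw [hφ, add_sub_cancel_right] at key
    have : 0 ≤ ∫ τ, m τ * φ.normed volume (τ - (b + (T' - b) / 4)) :=
      integral_nonneg fun τ => mul_nonneg (hm0 τ) (φ.nonneg_normed _)
    linarith

end Time

/-! ### The local energy estimate -/

section Cutoff

variable {X : Type*} [PseudoMetricSpace X] (x₀ : X) (L ρ : ℝ)

/-- The radial cutoff with slope `L` vanishing outside `ball x₀ ρ`. -/
def cutoff (x : X) : ℝ := max 0 (min 1 (L * (ρ - dist x x₀)))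

lemma cutoff_nonneg (x : X) : 0 ≤ cutoff x₀ L ρ x := le_max_left _ _

lemma cutoff_le_one (x : X) : cutoff x₀ L ρ x ≤ 1 := max_le zero_le_one (min_le_left _ _)

variable {L ρ}

lemma cutoff_eq_zero (hL : 0 ≤ L) {x : X} (hx : x ∉ ball x₀ ρ) : cutoff x₀ L ρ x = 0 := by
  rw [mem_ball, not_lt] at hx
  exact max_eq_left ((min_le_right _ _).trans (mul_nonpos_of_nonneg_of_nonpos hL (by linarith)))

lemma cutoff_eq_one {x : X} (hx : 1 ≤ L * (ρ - dist x x₀)) : cutoff x₀ L ρ x = 1 := by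
  rw [cutoff, min_eq_left hx, max_eq_right zero_le_one]

lemma abs_cutoff_sub_le (hL : 0 ≤ L) (x y : X) :
    |cutoff x₀ L ρ x - cutoff x₀ L ρ y| ≤ L * dist x y := by
  have h1 : |cutoff x₀ L ρ x - cutoff x₀ L ρ y|
      ≤ |L * (ρ - dist x x₀) - L * (ρ - dist y x₀)| := by
    unfold cutoff
    refine (abs_max_sub_max_le_max _ _ _ _).trans ?_
    rw [sub_self, abs_zero, max_eq_right (abs_nonneg _)]
    refine (abs_min_sub_min_le_max _ _ _ _).trans ?_
    rw [sub_self, abs_zero, max_eq_right (abs_nonneg _)]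
  refine h1.trans ?_
  rw [← mul_sub, abs_mul, abs_of_nonneg hL]
  refine mul_le_mul_of_nonneg_left ?_ hL
  rw [sub_sub_sub_cancel_left, dist_comm x y]
  exact abs_dist_sub_le y x x₀

lemma abs_sq_cutoff_sub_le (hL : 0 ≤ L) (x y : X) :
    |cutoff x₀ L ρ x ^ 2 - cutoff x₀ L ρ y ^ 2|
      ≤ L * dist x y * (cutoff x₀ L ρ x + cutoff x₀ L ρ y) := by
  rw [sq_sub_sq, abs_mul, mul_comm, abs_of_nonneg
    (add_nonneg (cutoff_nonneg x₀ L ρ x) (cutoff_nonneg x₀ L ρ y))]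
  exact mul_le_mul_of_nonneg_right (abs_cutoff_sub_le x₀ hL x y)
    (add_nonneg (cutoff_nonneg x₀ L ρ x) (cutoff_nonneg x₀ L ρ y))

lemma continuous_cutoff : Continuous (cutoff x₀ L ρ) :=
  continuous_const.max (continuous_const.min
    (continuous_const.mul (continuous_const.sub (continuous_id.dist continuous_const))))

lemma exists_lipschitzWith_sq_cutoff (hL : 0 ≤ L) :
    ∃ K, LipschitzWith K fun x => cutoff x₀ L ρ x ^ 2 := by
  refine ⟨Real.toNNReal (2 * L), LipschitzWith.of_dist_le_mul fun x y => ?_⟩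
  rw [Real.coe_toNNReal _ (by linarith), Real.dist_eq]
  refine (abs_sq_cutoff_sub_le x₀ hL x y).trans ?_
  have h1 := cutoff_le_one x₀ L ρ x
  have h2 := cutoff_le_one x₀ L ρ y
  have h3 : 0 ≤ L * dist x y := mul_nonneg hL dist_nonneg
  nlinarith

/-- The gradient of the squared cutoff is controlled by the cutoff itself, also where the cutoff is
not differentiable, since the gradient is then `0` by convention. -/
lemma norm_gradient_sq_cutoff_le {N : ℕ} (x₀ : EuclideanSpace ℝ (Fin N)) (hL : 0 ≤ L)
    (x : EuclideanSpace ℝ (Fin N)) :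
    ‖gradient (fun x => cutoff x₀ L ρ x ^ 2) x‖ ≤ 2 * L * cutoff x₀ L ρ x := by
  rw [gradient, LinearIsometryEquiv.norm_map]
  refine le_of_forall_pos_le_add fun ε hε => ?_
  have h0 := cutoff_nonneg x₀ L ρ x
  refine norm_fderiv_le_of_lip' ℝ (by positivity) ?_
  have hc : ∀ᶠ y in 𝓝 x, cutoff x₀ L ρ y < cutoff x₀ L ρ x + ε / (L + 1) :=
    (continuous_cutoff x₀).continuousAt.eventually (gt_mem_nhds (by
      have : 0 < ε / (L + 1) := by positivity
      linarith))
  filter_upwards [hc] with y hy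
  rw [Real.norm_eq_abs, ← dist_eq_norm]
  refine (abs_sq_cutoff_sub_le x₀ hL y x).trans ?_
  have h1 : L * (ε / (L + 1)) ≤ ε := by
    rw [mul_div_assoc', div_le_iff₀ (by linarith)]
    nlinarith
  have h2 : L * (cutoff x₀ L ρ y + cutoff x₀ L ρ x) ≤ 2 * L * cutoff x₀ L ρ x + ε := by
    nlinarith [mul_le_mul_of_nonneg_left hy.le hL]
  have := mul_le_mul_of_nonneg_right h2 (dist_nonneg (x := y) (y := x))
  linarith

end Cutoff

lemma integrable_mul_of_support_subset {α : Type*} [MeasurableSpace α] {μ : Measure α}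
    {f k : α → ℝ} {K : Set α} {C : ℝ} (hf : IntegrableOn f K μ) (hk : Measurable k)
    (hC : ∀ z, |k z| ≤ C) (hK : Function.support k ⊆ K) : Integrable (fun z => f z * k z) μ := by
  have h1 : IntegrableOn (fun z => f z * k z) K μ :=
    hf.mul_bdd hk.aestronglyMeasurable (ae_of_all _ hC)
  refine (integrableOn_iff_integrable_of_support_subset fun z hz => hK fun hc => hz ?_).1 h1
  simp [hc]

/-- The energy inequality at a point: Young's inequality absorbs half of `|∇G(u)|²`. -/
lemma flux_lower_bound {h P : ℝ → ℝ} (hP : IsCoefficientPair h P) {M C₁ : ℝ}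
    (hA1 : ∀ s ∈ Icc 0 M, F h P s ≤ C₁ * (G' h P s * G h P s)) {N : ℕ}
    {d ξ : EuclideanSpace ℝ (Fin N)} {s L ζ : ℝ} (hs : s ∈ Icc 0 M)
    (hL : 0 ≤ L) (hζ : 0 ≤ ζ) (hξ : ‖ξ‖ ≤ 2 * L * ζ) :
    1 / 2 * (derivF₀ h P s * ‖d‖ ^ 2 * ζ ^ 2) - 2 * C₁ ^ 2 * L ^ 2 * G h P s ^ 2
      ≤ F h P s * inner ℝ d ξ + derivF₀ h P s * ‖d‖ ^ 2 * ζ ^ 2 := by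
  rcases eq_or_lt_of_le hs.1 with rfl | hs0
  · simp [derivF₀, hP.F_at_zero, IsCoefficientPair.G_at_zero]
  · have hd : derivF₀ h P s = G' h P s ^ 2 := by rw [derivF₀, if_pos hs0, hP.G'_sq hs0]
    have hF := hA1 s hs
    have hF0 := (hP.F_pos hs0).le
    have hG := hP.G_nonneg hs.1
    have hG' : 0 ≤ G' h P s := Real.sqrt_nonneg _
    have h1 : F h P s * inner ℝ d ξ ≥ -(C₁ * (G' h P s * G h P s) * (‖d‖ * (2 * L * ζ))) := by
      have e1 : -(‖d‖ * (2 * L * ζ)) ≤ inner ℝ d ξ := by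
        have := abs_le.1 (abs_real_inner_le_norm d ξ)
        have h2 := mul_le_mul_of_nonneg_left hξ (norm_nonneg d)
        linarith [this.1]
      have e2 : 0 ≤ ‖d‖ * (2 * L * ζ) := by positivity
      have := mul_le_mul_of_nonneg_left e1 hF0
      have := mul_le_mul_of_nonneg_right hF e2
      linarith
    rw [hd]
    nlinarith [sq_nonneg (G' h P s * ‖d‖ * ζ - 2 * C₁ * L * G h P s)]

namespace IsBorelSolution

variable {N : ℕ} {h P : ℝ → ℝ} {S : Set (EuclideanSpace ℝ (Fin N))} {T M : ℝ}
  {v : EuclideanSpace ℝ (Fin N) × ℝ → ℝ}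
  {D : EuclideanSpace ℝ (Fin N) × ℝ → EuclideanSpace ℝ (Fin N)}

/-- The weak inequality tested with a squared cutoff, after absorption, as an inequality between
functions of time. -/
lemma time_inequality (hS : IsBorelSolution h P S T M v D) (hP : IsCoefficientPair h P)
    {C₁ : ℝ} (hA1 : ∀ s ∈ Icc 0 M, F h P s ≤ C₁ * (G' h P s * G h P s))
    {x₀ : EuclideanSpace ℝ (Fin N)} {L ρ : ℝ} (hL : 0 ≤ L) (hρ : closedBall x₀ ρ ⊆ S)
    {η : ℝ → ℝ} (hη : ContDiff ℝ ∞ η) (hηc : HasCompactSupport η) (hηT : tsupport η ⊆ Ioo 0 T)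
    (hη0 : ∀ t, 0 ≤ η t) :
    ∫ t, (∫ x, 1 / 2 * (derivF₀ h P (v (x, t)) * ‖D (x, t)‖ ^ 2 * cutoff x₀ L ρ x ^ 2)) * η t ≤
      (∫ t, (∫ x, H h (v (x, t)) * cutoff x₀ L ρ x ^ 2) * deriv η t) +
      ∫ t, (∫ x in ball x₀ ρ, 2 * C₁ ^ 2 * L ^ 2 * G h P (v (x, t)) ^ 2) * η t := by
  set ζ := cutoff x₀ L ρ with hζdef
  have hζ0 : ∀ x, 0 ≤ ζ x := cutoff_nonneg x₀ L ρ
  have hζ1 : ∀ x, ζ x ≤ 1 := cutoff_le_one x₀ L ρ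
  have hζc : Continuous ζ := continuous_cutoff x₀
  have hζs : ∀ x, x ∉ ball x₀ ρ → ζ x = 0 := fun x hx => cutoff_eq_zero x₀ hL hx
  set θ : EuclideanSpace ℝ (Fin N) → ℝ := fun x => ζ x ^ 2 with hθ
  have hθsupp : Function.support θ ⊆ closedBall x₀ ρ := by
    intro x hx
    by_contra hc
    exact hx (by simp [hθ, hζs x fun hh => hc (ball_subset_closedBall hh)])
  have hθts : tsupport θ ⊆ closedBall x₀ ρ := closure_minimal hθsupp isClosed_closedBall
  have hθc : HasCompactSupport θ :=
    HasCompactSupport.of_support_subset_isCompact (isCompact_closedBall _ _) hθsupp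
  have main := hS.weak_ineq θ η (exists_lipschitzWith_sq_cutoff x₀ hL) hθc (hθts.trans hρ)
    (fun x => sq_nonneg _) hη hηc hηT hη0
  set K := closedBall x₀ ρ ×ˢ tsupport η with hK
  have hKc : IsCompact K := (isCompact_closedBall _ _).prod hηc
  have hKU : K ⊆ S ×ˢ Ioo 0 T := prod_mono hρ hηT
  have hM : 0 ≤ M := (hS.mem_Icc 0).1.trans (hS.mem_Icc 0).2
  obtain ⟨Cη, hCη⟩ := hη.continuous.bounded_above_of_compact_support hηc
  have hη'c : HasCompactSupport (deriv η) := hηc.deriv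
  have hη' : Continuous (deriv η) := hη.continuous_deriv (by simp)
  obtain ⟨Cη', hCη'⟩ := hη'.bounded_above_of_compact_support hη'c
  have mF : Measurable fun z => F h P (v z) := measurable_comp_of_continuousOn
    (hP.F_continuousOn.mono fun _ hx => hx.1) hS.measurable_v hS.mem_Icc
  have mH : Measurable fun z => H h (v z) := measurable_comp_of_continuousOn
    (hP.H_continuousOn hM) hS.measurable_v hS.mem_Icc
  have mG := measurable_G_comp hP hS.measurable_v hS.mem_Icc
  have bF : ∀ z, |F h P (v z)| ≤ F h P M := fun z => by
    have := hP.F_mono (mem_Ici.2 le_rfl) (mem_Ici.2 (hS.mem_Icc z).1) (hS.mem_Icc z).1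
    rw [hP.F_at_zero] at this
    rw [abs_of_nonneg this]
    exact hP.F_mono (mem_Ici.2 (hS.mem_Icc z).1) (mem_Ici.2 hM) (hS.mem_Icc z).2
  have bH : ∀ z, |H h (v z)| ≤ H h M := fun z => by
    rw [abs_of_nonneg (hP.H_nonneg (hS.mem_Icc z).1)]
    exact hP.H_mono (mem_Ici.2 (hS.mem_Icc z).1) (mem_Ici.2 hM) (hS.mem_Icc z).2
  have bG : ∀ z, |G h P (v z)| ≤ G h P M := fun z => by
    rw [abs_of_nonneg (hP.G_nonneg (hS.mem_Icc z).1)]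
    exact hP.G_mono (mem_Ici.2 (hS.mem_Icc z).1) (mem_Ici.2 hM) (hS.mem_Icc z).2
  have hKη : ∀ {x t}, x ∈ closedBall x₀ ρ → η t ≠ 0 → (x, t) ∈ K := fun hx ht =>
    ⟨hx, subset_tsupport _ ht⟩
  have hKη' : ∀ {x t}, x ∈ closedBall x₀ ρ → deriv η t ≠ 0 → (x, t) ∈ K := fun hx ht =>
    ⟨hx, support_deriv_subset ht⟩
  -- integrability of the terms
  have hone : ∀ {f : EuclideanSpace ℝ (Fin N) × ℝ → ℝ} {C : ℝ}, Measurable f →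
      (∀ z, |f z| ≤ C) → IntegrableOn f K := fun hf hC =>
    Measure.integrableOn_of_bounded hKc.measure_lt_top.ne hf.aestronglyMeasurable (ae_of_all _ hC)
  have mθ : Measurable fun z : EuclideanSpace ℝ (Fin N) × ℝ => θ z.1 :=
    ((hζc.pow 2).measurable).comp measurable_fst
  have bθ : ∀ x, |θ x| ≤ 1 := fun x => by
    rw [abs_of_nonneg (sq_nonneg _)]
    exact pow_le_one₀ (hζ0 x) (hζ1 x)
  have mη : Measurable fun z : EuclideanSpace ℝ (Fin N) × ℝ => η z.2 :=
    hη.continuous.measurable.comp measurable_snd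
  have mη' : Measurable fun z : EuclideanSpace ℝ (Fin N) × ℝ => deriv η z.2 :=
    hη'.measurable.comp measurable_snd
  have iH : Integrable fun z : EuclideanSpace ℝ (Fin N) × ℝ =>
      H h (v z) * (θ z.1 * deriv η z.2) := by
    refine integrable_mul_of_support_subset (C := 1 * Cη') (hone mH bH) (mθ.mul mη') ?_ ?_
    · intro z
      rw [abs_mul]
      exact mul_le_mul (bθ _) (hCη' _) (abs_nonneg _) zero_le_one
    · intro z hz
      rw [Function.mem_support, mul_ne_zero_iff] at hz
      exact hKη' (hθsupp hz.1) hz.2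
  have bθη : ∀ z : EuclideanSpace ℝ (Fin N) × ℝ, |θ z.1 * η z.2| ≤ 1 * Cη := fun z => by
    rw [abs_mul]
    exact mul_le_mul (bθ _) (hCη _) (abs_nonneg _) zero_le_one
  have sθη : Function.support (fun z : EuclideanSpace ℝ (Fin N) × ℝ => θ z.1 * η z.2) ⊆ K := by
    intro z hz
    rw [Function.mem_support, mul_ne_zero_iff] at hz
    exact hKη (hθsupp hz.1) hz.2
  have iE : Integrable fun z : EuclideanSpace ℝ (Fin N) × ℝ =>
      derivF₀ h P (v z) * ‖D z‖ ^ 2 * (θ z.1 * η z.2) :=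
    integrable_mul_of_support_subset (hS.integrableOn_energy K hKU hKc) (mθ.mul mη) bθη sθη
  have mgrad : Measurable fun z : EuclideanSpace ℝ (Fin N) × ℝ => gradient θ z.1 := by
    have : Measurable (gradient θ) :=
      (InnerProductSpace.toDual ℝ (EuclideanSpace ℝ (Fin N))).symm.continuous.measurable.comp
        (measurable_fderiv ℝ θ)
    exact this.comp measurable_fst
  have bgrad : ∀ x, ‖gradient θ x‖ ≤ 2 * L * ζ x := norm_gradient_sq_cutoff_le x₀ hL
  have iflux : Integrable fun z : EuclideanSpace ℝ (Fin N) × ℝ =>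
      F h P (v z) * inner ℝ (D z) (gradient θ z.1) * η z.2 := by
    have i0 : IntegrableOn (fun z : EuclideanSpace ℝ (Fin N) × ℝ =>
        inner ℝ (D z) (gradient θ z.1)) K := by
      refine ((hS.integrableOn_D K hKU hKc).norm.mul_const (2 * L)).mono'
        (hS.measurable_D.inner mgrad).aestronglyMeasurable (ae_of_all _ fun z => ?_)
      refine (abs_real_inner_le_norm _ _).trans (mul_le_mul_of_nonneg_left ?_ (norm_nonneg _))
      refine (bgrad z.1).trans ?_
      nlinarith [hζ1 z.1]
    have i1 := integrable_mul_of_support_subset (k := fun z : EuclideanSpace ℝ (Fin N) × ℝ =>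
      F h P (v z) * (K.indicator (fun _ => (1:ℝ)) z * η z.2)) (C := F h P M * (1 * Cη)) i0
      (mF.mul ((measurable_const.indicator hKc.isClosed.measurableSet).mul mη)) ?_ ?_
    · refine i1.congr (ae_of_all _ fun z => ?_)
      simp only
      by_cases hz : z ∈ K
      · rw [indicator_of_mem hz]
        ring
      · rw [indicator_of_notMem hz]
        by_cases hzη : η z.2 = 0
        · simp [hzη]
        · have hzb : z.1 ∉ closedBall x₀ ρ := fun hh => hz (hKη hh hzη)
          have : gradient θ z.1 = 0 := by
            have h1 := bgrad z.1
            rw [hζs z.1 fun hh => hzb (ball_subset_closedBall hh), mul_zero] at h1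
            exact norm_le_zero_iff.1 h1
          simp [this]
    · intro z
      rw [abs_mul, abs_mul]
      refine mul_le_mul (bF z) (mul_le_mul ?_ (hCη _) (abs_nonneg _) zero_le_one)
        (by positivity) ((abs_nonneg _).trans (bF z))
      by_cases hz : z ∈ K <;> simp [hz]
    · intro z hz
      by_contra hc
      exact hz (by simp [hc])
  have iG : Integrable fun z : EuclideanSpace ℝ (Fin N) × ℝ => 2 * C₁ ^ 2 * L ^ 2 *
      G h P (v z) ^ 2 * ((ball x₀ ρ).indicator (fun _ => (1:ℝ)) z.1 * η z.2) := by
    have mb : Measurable fun z : EuclideanSpace ℝ (Fin N) × ℝ =>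
        (ball x₀ ρ).indicator (fun _ => (1:ℝ)) z.1 :=
      (measurable_const.indicator measurableSet_ball).comp measurable_fst
    refine integrable_mul_of_support_subset (C := 1 * Cη)
      (hone (C := 2 * C₁ ^ 2 * L ^ 2 * G h P M ^ 2) ((mG.pow_const 2).const_mul _) ?_)
      (mb.mul mη) ?_ ?_
    · intro z
      rw [abs_mul, abs_of_nonneg (by positivity : 0 ≤ 2 * C₁ ^ 2 * L ^ 2), abs_pow]
      gcongr
      exact bG z
    · intro z
      rw [abs_mul]
      refine mul_le_mul ?_ (hCη _) (abs_nonneg _) zero_le_one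
      by_cases hz : z.1 ∈ ball x₀ ρ <;> simp [hz]
    · intro z hz
      rw [Function.mem_support, mul_ne_zero_iff] at hz
      refine hKη ?_ hz.2
      by_contra hc
      exact hz.1 (indicator_of_notMem (fun hh => hc (ball_subset_closedBall hh)) _)
  -- the pointwise bound, integrated
  have key : (∫ z : EuclideanSpace ℝ (Fin N) × ℝ,
        1 / 2 * (derivF₀ h P (v z) * ‖D z‖ ^ 2 * (θ z.1 * η z.2)))
      - (∫ z : EuclideanSpace ℝ (Fin N) × ℝ, 2 * C₁ ^ 2 * L ^ 2 *
          G h P (v z) ^ 2 * ((ball x₀ ρ).indicator (fun _ => (1:ℝ)) z.1 * η z.2))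
      - ∫ z : EuclideanSpace ℝ (Fin N) × ℝ, H h (v z) * (θ z.1 * deriv η z.2) ≤ 0 := by
    have iEG : Integrable fun z : EuclideanSpace ℝ (Fin N) × ℝ =>
        1 / 2 * (derivF₀ h P (v z) * ‖D z‖ ^ 2 * (θ z.1 * η z.2)) - 2 * C₁ ^ 2 * L ^ 2 *
          G h P (v z) ^ 2 * ((ball x₀ ρ).indicator (fun _ => (1:ℝ)) z.1 * η z.2) :=
      (iE.const_mul (1 / 2)).sub iG
    rw [← integral_sub (iE.const_mul (1 / 2)) iG, ← integral_sub iEG iH]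
    refine le_trans (integral_mono (iEG.sub iH) ?_ fun z => ?_) main
    · refine ((iH.neg).add (iflux.add iE)).congr (ae_of_all _ fun z => ?_)
      simp only [Pi.add_apply, Pi.neg_apply]
      ring
    · have hb : 1 / 2 * (derivF₀ h P (v z) * ‖D z‖ ^ 2 * θ z.1) - 2 * C₁ ^ 2 * L ^ 2 *
          G h P (v z) ^ 2 * (ball x₀ ρ).indicator (fun _ => (1:ℝ)) z.1
          ≤ F h P (v z) * inner ℝ (D z) (gradient θ z.1)
            + derivF₀ h P (v z) * ‖D z‖ ^ 2 * θ z.1 := by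
        by_cases hz : z.1 ∈ ball x₀ ρ
        · rw [indicator_of_mem hz, mul_one]
          exact flux_lower_bound hP hA1 (hS.mem_Icc z) hL (hζ0 z.1) (bgrad z.1)
        · have h1 := bgrad z.1
          rw [hζs z.1 hz, mul_zero] at h1
          have h2 := norm_le_zero_iff.1 h1
          rw [indicator_of_notMem hz, h2]
          simp [hθ, hζs z.1 hz]
      have := mul_le_mul_of_nonneg_right hb (hη0 z.2)
      simp only
      linarith
  have e1 : ∫ z : EuclideanSpace ℝ (Fin N) × ℝ,
      1 / 2 * (derivF₀ h P (v z) * ‖D z‖ ^ 2 * (θ z.1 * η z.2))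
      = ∫ t, (∫ x, 1 / 2 * (derivF₀ h P (v (x, t)) * ‖D (x, t)‖ ^ 2 * θ x)) * η t := by
    rw [Measure.volume_eq_prod, integral_prod_symm _ (iE.const_mul (1 / 2))]
    congr 1 with t
    rw [← integral_mul_const]
    congr 1 with x
    ring
  have e2 : ∫ z : EuclideanSpace ℝ (Fin N) × ℝ, H h (v z) * (θ z.1 * deriv η z.2)
      = ∫ t, (∫ x, H h (v (x, t)) * θ x) * deriv η t := by
    rw [Measure.volume_eq_prod, integral_prod_symm _ iH]
    congr 1 with t
    rw [← integral_mul_const]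
    congr 1 with x
    ring
  have e3 : ∫ z : EuclideanSpace ℝ (Fin N) × ℝ, 2 * C₁ ^ 2 * L ^ 2 *
        G h P (v z) ^ 2 * ((ball x₀ ρ).indicator (fun _ => (1:ℝ)) z.1 * η z.2)
      = ∫ t, (∫ x in ball x₀ ρ, 2 * C₁ ^ 2 * L ^ 2 * G h P (v (x, t)) ^ 2) * η t := by
    rw [Measure.volume_eq_prod, integral_prod_symm _ iG]
    congr 1 with t
    rw [← integral_indicator measurableSet_ball, ← integral_mul_const]
    congr 1 with x
    by_cases hx : x ∈ ball x₀ ρ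
    · simp [hx]
    · simp [hx]
  rw [e1, e2, e3] at key
  linarith

end IsBorelSolution

namespace IsBorelSolution

variable {N : ℕ} {h P : ℝ → ℝ} {S : Set (EuclideanSpace ℝ (Fin N))} {T M : ℝ}
  {v : EuclideanSpace ℝ (Fin N) × ℝ → ℝ}
  {D : EuclideanSpace ℝ (Fin N) × ℝ → EuclideanSpace ℝ (Fin N)}

lemma H_comp_bounds (hS : IsBorelSolution h P S T M v D) (hP : IsCoefficientPair h P)
    (z : EuclideanSpace ℝ (Fin N) × ℝ) : 0 ≤ H h (v z) ∧ H h (v z) ≤ H h M :=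
  ⟨hP.H_nonneg (hS.mem_Icc z).1, hP.H_mono (mem_Ici.2 (hS.mem_Icc z).1)
    (mem_Ici.2 ((hS.mem_Icc z).1.trans (hS.mem_Icc z).2)) (hS.mem_Icc z).2⟩

lemma G_comp_bounds (hS : IsBorelSolution h P S T M v D) (hP : IsCoefficientPair h P)
    (z : EuclideanSpace ℝ (Fin N) × ℝ) : 0 ≤ G h P (v z) ∧ G h P (v z) ≤ G h P M :=
  ⟨hP.G_nonneg (hS.mem_Icc z).1, hP.G_mono (mem_Ici.2 (hS.mem_Icc z).1)
    (mem_Ici.2 ((hS.mem_Icc z).1.trans (hS.mem_Icc z).2)) (hS.mem_Icc z).2⟩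

lemma measurable_H_comp (hS : IsBorelSolution h P S T M v D) (hP : IsCoefficientPair h P) :
    Measurable fun z => H h (v z) :=
  measurable_comp_of_continuousOn
    (hP.H_continuousOn ((hS.mem_Icc 0).1.trans (hS.mem_Icc 0).2)) hS.measurable_v hS.mem_Icc

lemma integrable_H_slice (hS : IsBorelSolution h P S T M v D) (hP : IsCoefficientPair h P)
    {x₀ : EuclideanSpace ℝ (Fin N)} {L ρ : ℝ} (hL : 0 ≤ L) (t : ℝ) :
    Integrable fun x => H h (v (x, t)) * cutoff x₀ L ρ x ^ 2 := by
  refine integrable_mul_of_support_subset (K := closedBall x₀ ρ) (C := 1)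
    (Measure.integrableOn_of_bounded (M := H h M) measure_closedBall_lt_top.ne
      ((hS.measurable_H_comp hP).comp measurable_prodMk_right).aestronglyMeasurable
      (ae_of_all _ fun x => ?_)) ((continuous_cutoff x₀).pow 2).measurable (fun x => ?_) ?_
  · rw [Real.norm_of_nonneg (hS.H_comp_bounds hP _).1]
    exact (hS.H_comp_bounds hP _).2
  · rw [abs_of_nonneg (sq_nonneg _)]
    exact pow_le_one₀ (cutoff_nonneg _ _ _ _) (cutoff_le_one _ _ _ _)
  · intro x hx
    by_contra hc
    exact hx (by simp [cutoff_eq_zero x₀ hL fun hh => hc (ball_subset_closedBall hh)])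

/-- The localised mass `∫ H(v) ζ²` tends to `0` at the initial time. -/
lemma mass_initial (hS : IsBorelSolution h P S T M v D) (hP : IsCoefficientPair h P)
    {x₀ : EuclideanSpace ℝ (Fin N)} {L ρ : ℝ} (hL : 0 ≤ L) (hρ : closedBall x₀ ρ ⊆ S)
    {ε : ℝ} (hε : 0 < ε) :
    ∃ s₀ > 0, ∀ᵐ s ∂(volume.restrict (Ioo 0 s₀)),
      ∫ x, H h (v (x, s)) * cutoff x₀ L ρ x ^ 2 ≤ ε := by
  set K := closedBall x₀ ρ with hK
  have hM : 0 ≤ M := (hS.mem_Icc 0).1.trans (hS.mem_Icc 0).2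
  have hHM : 0 ≤ H h M := hP.H_nonneg hM
  set κ := volume.real K
  have hκ : 0 ≤ κ := measureReal_nonneg
  -- choose a level `δ` with `H(δ) |K| + δ H(M) ≤ ε`
  obtain ⟨δ, hδ0, hδ1, hδ2⟩ : ∃ δ, 0 < δ ∧ H h δ * κ ≤ ε / 2 ∧ δ * H h M ≤ ε / 2 := by
    have h1 : Tendsto (H h) (𝓝[>] 0) (𝓝 0) := by
      have := (hP.H_continuousOn zero_le_one) 0 (by simp)
      rw [ContinuousWithinAt, IsCoefficientPair.H_at_zero] at this
      refine this.mono_left ?_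
      rw [← nhdsWithin_Ioo_eq_nhdsGT zero_lt_one]
      exact nhdsWithin_mono _ Ioo_subset_Icc_self
    have h2 : ∀ᶠ δ in 𝓝[>] (0:ℝ), H h δ * κ < ε / 2 := by
      have := h1.mul_const κ
      rw [zero_mul] at this
      exact this.eventually (gt_mem_nhds (by linarith))
    have h3 : ∀ᶠ δ in 𝓝[>] (0:ℝ), δ * H h M < ε / 2 := by
      have : Tendsto (fun δ : ℝ => δ * H h M) (𝓝 0) (𝓝 (0 * H h M)) :=
        (continuous_id.mul continuous_const).tendsto 0
      rw [zero_mul] at this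
      exact (this.mono_left nhdsWithin_le_nhds).eventually (gt_mem_nhds (by linarith))
    obtain ⟨δ, ⟨h2, h3⟩, h4⟩ := ((h2.and h3).and self_mem_nhdsWithin).exists
    exact ⟨δ, h4, h2.le, h3.le⟩
  obtain ⟨s₀, hs₀, hs⟩ := hS.initial K hρ (isCompact_closedBall _ _) δ hδ0
  refine ⟨s₀, hs₀, ?_⟩
  filter_upwards [hs] with s hs
  set A := {x ∈ K | δ ≤ v (x, s)} with hA
  have hKm : MeasurableSet K := measurableSet_closedBall
  have hKf : volume K ≠ ⊤ := measure_closedBall_lt_top.ne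
  have hAm : MeasurableSet A := hKm.inter
    (measurableSet_le measurable_const (hS.measurable_v.comp measurable_prodMk_right))
  have hAf : volume A ≠ ⊤ := ((measure_mono (sep_subset _ _)).trans_lt hKf.lt_top).ne
  have hAr : volume.real A ≤ δ := ENNReal.toReal_le_of_le_ofReal hδ0.le hs
  have i1 : Integrable (A.indicator fun _ => H h M) :=
    (integrable_indicator_iff hAm).2 (integrableOn_const hAf)
  have i2 : Integrable (K.indicator fun _ => H h δ) :=
    (integrable_indicator_iff hKm).2 (integrableOn_const hKf)
  calc ∫ x, H h (v (x, s)) * cutoff x₀ L ρ x ^ 2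
      ≤ ∫ x, (A.indicator (fun _ => H h M) x + K.indicator (fun _ => H h δ) x) := by
        refine integral_mono (hS.integrable_H_slice hP hL s) (i1.add i2) fun x => ?_
        have hb := hS.H_comp_bounds hP (x, s)
        have hH0 : 0 ≤ H h δ := hP.H_nonneg hδ0.le
        by_cases hx : x ∈ K
        · have hz : cutoff x₀ L ρ x ^ 2 ≤ 1 :=
            pow_le_one₀ (cutoff_nonneg _ _ _ _) (cutoff_le_one _ _ _ _)
          have h1 : H h (v (x, s)) * cutoff x₀ L ρ x ^ 2 ≤ H h (v (x, s)) :=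
            mul_le_of_le_one_right hb.1 hz
          by_cases hxA : x ∈ A
          · simp only [indicator_of_mem hx, indicator_of_mem hxA]
            linarith
          · simp only [indicator_of_mem hx, indicator_of_notMem hxA]
            have hv : v (x, s) ≤ δ := by
              by_contra hc
              exact hxA ⟨hx, (not_le.1 hc).le⟩
            have := hP.H_mono (mem_Ici.2 (hS.mem_Icc (x, s)).1) (mem_Ici.2 hδ0.le) hv
            linarith
        · have hz := cutoff_eq_zero (L := L) x₀ hL fun hh => hx (ball_subset_closedBall hh)
          have hxA : x ∉ A := fun hh => hx hh.1
          simp [hz, hx, hxA]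
    _ = volume.real A * H h M + κ * H h δ := by
        rw [integral_add i1 i2, integral_indicator_const _ hAm, integral_indicator_const _ hKm,
          smul_eq_mul, smul_eq_mul]
    _ ≤ ε := by
        have := mul_le_mul_of_nonneg_right hAr hHM
        linarith

/-- The local energy estimate: on a smaller ball, the mass `∫ G(v)^lam` at almost every time and
the energy `∬ |∇G(v)|²` are bounded by `∬ G(v)²` over the larger ball. -/
lemma energy_estimate (hS : IsBorelSolution h P S T M v D) (hP : IsCoefficientPair h P)
    {C₁ C₂ lam : ℝ} (hA1 : ∀ s ∈ Icc 0 M, F h P s ≤ C₁ * (G' h P s * G h P s)) (hC₂ : 0 < C₂)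
    (hlam : 0 < lam) (hA2 : ∀ s ∈ Icc 0 M, (√(s * F h P s)) ^ lam ≤ C₂ * H h s)
    {x₀ : EuclideanSpace ℝ (Fin N)} {L ρ₁ ρ₂ T' : ℝ} (hT' : T' ≤ T)
    (hρ : closedBall x₀ ρ₁ ⊆ S) (hL0 : 0 ≤ L) (hL : 1 ≤ L * (ρ₁ - ρ₂)) :
    (∀ᵐ t ∂(volume.restrict (Ioo 0 T')),
      ∫⁻ x in ball x₀ ρ₂, ENNReal.ofReal (G h P (v (x, t)) ^ lam) ≤
        ENNReal.ofReal (C₂ * (2 * C₁ ^ 2 * L ^ 2)) *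
          ∫⁻ z in ball x₀ ρ₁ ×ˢ Ioo 0 T', ENNReal.ofReal (G h P (v z) ^ 2)) ∧
    ∫⁻ z in ball x₀ ρ₂ ×ˢ Ioo 0 T', ENNReal.ofReal (derivF₀ h P (v z) * ‖D z‖ ^ 2) ≤
      ENNReal.ofReal (2 * (2 * C₁ ^ 2 * L ^ 2)) *
        ∫⁻ z in ball x₀ ρ₁ ×ˢ Ioo 0 T', ENNReal.ofReal (G h P (v z) ^ 2) := by
  set c := 2 * C₁ ^ 2 * L ^ 2 with hc
  have hc0 : 0 ≤ c := by positivity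
  set ζ := cutoff x₀ L ρ₁ with hζ
  have hζ0 : ∀ x, 0 ≤ ζ x := cutoff_nonneg x₀ L ρ₁
  have hζ1 : ∀ x, ζ x ^ 2 ≤ 1 := fun x => pow_le_one₀ (hζ0 x) (cutoff_le_one x₀ L ρ₁ x)
  have hζm : Measurable ζ := (continuous_cutoff x₀).measurable
  have hζone : ∀ x ∈ ball x₀ ρ₂, ζ x = 1 := fun x hx => by
    refine cutoff_eq_one x₀ (hL.trans (mul_le_mul_of_nonneg_left ?_ hL0))
    linarith [mem_ball.1 hx]
  set K := closedBall x₀ ρ₁ with hK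
  have hζK : ∀ x, x ∉ K → ζ x = 0 := fun x hx =>
    cutoff_eq_zero x₀ hL0 fun hh => hx (ball_subset_closedBall hh)
  have mH := hS.measurable_H_comp hP
  have mG := measurable_G_comp hP hS.measurable_v hS.mem_Icc
  have hGM := hS.G_comp_bounds hP
  have mE : Measurable fun z => derivF₀ h P (v z) * ‖D z‖ ^ 2 :=
    (measurable_derivF₀.comp hS.measurable_v).mul (hS.measurable_D.norm.pow_const 2)
  have mζ : Measurable fun z : EuclideanSpace ℝ (Fin N) × ℝ => ζ z.1 ^ 2 :=
    (hζm.comp measurable_fst).pow_const 2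
  have hE0 : ∀ z, 0 ≤ derivF₀ h P (v z) * ‖D z‖ ^ 2 := fun z =>
    mul_nonneg (hP.derivF₀_nonneg _) (sq_nonneg _)
  set m : ℝ → ℝ := fun t => ∫ x, H h (v (x, t)) * ζ x ^ 2 with hm
  set g : ℝ → ℝ := fun t => ∫ x, 1 / 2 * (derivF₀ h P (v (x, t)) * ‖D (x, t)‖ ^ 2 * ζ x ^ 2) with hg
  set q : ℝ → ℝ := fun t => ∫ x in ball x₀ ρ₁, c * G h P (v (x, t)) ^ 2 with hq
  have hmm : Measurable m :=
    ((mH.mul mζ).stronglyMeasurable.integral_prod_left').measurable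
  have hm0 : ∀ t, 0 ≤ m t := fun t =>
    integral_nonneg fun x => mul_nonneg (hS.H_comp_bounds hP _).1 (sq_nonneg _)
  have hmB : ∀ t, |m t| ≤ H h M * volume.real K := by
    intro t
    have : m t = ∫ x in K, H h (v (x, t)) * ζ x ^ 2 :=
      (setIntegral_eq_integral_of_forall_compl_eq_zero fun x hx => by simp [hζK x hx]).symm
    rw [this, ← Real.norm_eq_abs]
    refine norm_setIntegral_le_of_norm_le_const measure_closedBall_lt_top fun x _ => ?_
    have hb := hS.H_comp_bounds hP (x, t)
    rw [Real.norm_of_nonneg (mul_nonneg hb.1 (sq_nonneg _))]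
    exact (mul_le_of_le_one_right hb.1 (hζ1 x)).trans hb.2
  have hg0 : ∀ t, 0 ≤ g t := fun t => integral_nonneg fun x =>
    mul_nonneg (by norm_num) (mul_nonneg (hE0 _) (sq_nonneg _))
  -- the truncated energy density is integrable, so that Fubini's theorem applies
  have iE : ∀ a b, 0 < a → b < T → Integrable (fun z : EuclideanSpace ℝ (Fin N) × ℝ =>
      1 / 2 * (derivF₀ h P (v z) * ‖D z‖ ^ 2 * ζ z.1 ^ 2))
        ((volume : Measure (EuclideanSpace ℝ (Fin N))).prod (volume.restrict (Icc a b))) := by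
    intro a b ha hb
    have h1 : IntegrableOn (fun z => derivF₀ h P (v z) * ‖D z‖ ^ 2) (K ×ˢ Icc a b) :=
      hS.integrableOn_energy _ (prod_mono hρ fun t ht => ⟨ha.trans_le ht.1, ht.2.trans_lt hb⟩)
        ((isCompact_closedBall _ _).prod isCompact_Icc)
    rw [IntegrableOn, Measure.volume_eq_prod, ← Measure.prod_restrict] at h1
    refine Integrable.const_mul ?_ _
    have h2 : (volume : Measure (EuclideanSpace ℝ (Fin N))).prod (volume.restrict (Icc a b))
        = (volume.prod volume).restrict (univ ×ˢ Icc a b) := by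
      rw [← Measure.prod_restrict, Measure.restrict_univ]
    have h3 : (((volume : Measure (EuclideanSpace ℝ (Fin N))).prod
        (volume.restrict (Icc a b))).restrict (K ×ˢ univ))
        = (volume.restrict K).prod (volume.restrict (Icc a b)) := by
      rw [← Measure.prod_restrict, Measure.restrict_univ]
    refine integrable_mul_of_support_subset (K := K ×ˢ univ) (C := 1) ?_ mζ (fun z => ?_) ?_
    · rw [IntegrableOn, h3]
      exact h1
    · rw [abs_of_nonneg (sq_nonneg _)]
      exact hζ1 _
    · intro z hz
      refine ⟨?_, mem_univ _⟩
      by_contra hh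
      exact hz (by simp [hζK z.1 hh])
  have hgi : ∀ a b, 0 < a → b < T → IntegrableOn g (Icc a b) := fun a b ha hb =>
    (iE a b ha hb).integral_prod_right
  have hq0 : ∀ t, 0 ≤ q t := fun t => integral_nonneg fun x => mul_nonneg hc0 (sq_nonneg _)
  have iQ : Integrable (fun z : EuclideanSpace ℝ (Fin N) × ℝ => c * G h P (v z) ^ 2)
      ((volume.restrict (ball x₀ ρ₁)).prod (volume.restrict (Ioo 0 T'))) := by
    have : IsFiniteMeasure (volume.restrict (ball x₀ ρ₁)) :=
      ⟨by rw [Measure.restrict_apply_univ]; exact measure_ball_lt_top⟩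
    refine Integrable.of_bound ((mG.pow_const 2).const_mul c).aestronglyMeasurable
      (c * G h P M ^ 2) (ae_of_all _ fun z => ?_)
    rw [Real.norm_of_nonneg (mul_nonneg hc0 (sq_nonneg _))]
    exact mul_le_mul_of_nonneg_left (pow_le_pow_left₀ (hGM z).1 (hGM z).2 2) hc0
  have hqi : IntegrableOn q (Ioo 0 T') := iQ.integral_prod_right
  have hQ : ENNReal.ofReal (∫ τ in Ioo 0 T', q τ) = ENNReal.ofReal c *
      ∫⁻ z in ball x₀ ρ₁ ×ˢ Ioo 0 T', ENNReal.ofReal (G h P (v z) ^ 2) := by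
    rw [hq, ← integral_prod_symm _ iQ, ofReal_integral_eq_lintegral_ofReal iQ
      (ae_of_all _ fun z => mul_nonneg hc0 (sq_nonneg _)), Measure.prod_restrict,
      ← lintegral_const_mul' _ _ ENNReal.ofReal_ne_top]
    simp only [ENNReal.ofReal_mul hc0]
    rfl
  obtain ⟨H1, H2⟩ := ae_le_and_integral_le hT' hmm hmB hm0 hg0 hgi hq0 hqi
    (fun η hη hηc hηT hη0 => hS.time_inequality hP hA1 hL0 hρ hη hηc hηT hη0)
    (fun ε hε => hS.mass_initial hP hL0 hρ hε)
  constructor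
  · filter_upwards [H1] with t ht
    calc ∫⁻ x in ball x₀ ρ₂, ENNReal.ofReal (G h P (v (x, t)) ^ lam)
        ≤ ∫⁻ x in ball x₀ ρ₂, ENNReal.ofReal (C₂ * (H h (v (x, t)) * ζ x ^ 2)) := by
          refine setLIntegral_mono' measurableSet_ball fun x hx => ENNReal.ofReal_le_ofReal ?_
          rw [hζone x hx, one_pow, mul_one]
          refine le_trans ?_ (hA2 _ (hS.mem_Icc _))
          exact Real.rpow_le_rpow (hGM _).1 (hP.G_le_sqrt (hS.mem_Icc _).1) hlam.le
      _ ≤ ∫⁻ x, ENNReal.ofReal (C₂ * (H h (v (x, t)) * ζ x ^ 2)) := setLIntegral_le_lintegral _ _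
      _ = ENNReal.ofReal (C₂ * m t) := by
          rw [hm, ← integral_const_mul, ofReal_integral_eq_lintegral_ofReal
            ((hS.integrable_H_slice hP hL0 t).const_mul C₂)
            (ae_of_all _ fun x => mul_nonneg hC₂.le
              (mul_nonneg (hS.H_comp_bounds hP _).1 (sq_nonneg _)))]
      _ ≤ ENNReal.ofReal (C₂ * ∫ τ in Ioo 0 T', q τ) :=
          ENNReal.ofReal_le_ofReal (mul_le_mul_of_nonneg_left ht hC₂.le)
      _ = _ := by rw [ENNReal.ofReal_mul hC₂.le, hQ, ENNReal.ofReal_mul hC₂.le, mul_assoc]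
  · have hstep : ∀ a b, 0 < a → b < T' →
        ∫⁻ z in ball x₀ ρ₂ ×ˢ Ioo a b, ENNReal.ofReal (derivF₀ h P (v z) * ‖D z‖ ^ 2)
          ≤ ENNReal.ofReal (2 * ∫ τ in Ioo 0 T', q τ) := by
      intro a b ha hb
      rcases lt_or_ge a b with hab | hab
      swap
      · simp [Ioo_eq_empty_of_le hab]
      have iE' := (iE a b ha (hb.trans_le hT')).mono_measure
        (Measure.prod_mono le_rfl (Measure.restrict_mono (Ioo_subset_Icc_self (a := a) (b := b))
          (le_refl (volume : Measure ℝ))))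
      calc ∫⁻ z in ball x₀ ρ₂ ×ˢ Ioo a b, ENNReal.ofReal (derivF₀ h P (v z) * ‖D z‖ ^ 2)
          ≤ ∫⁻ z in ball x₀ ρ₂ ×ˢ Ioo a b, ENNReal.ofReal
              (2 * (1 / 2 * (derivF₀ h P (v z) * ‖D z‖ ^ 2 * ζ z.1 ^ 2))) := by
            refine setLIntegral_mono' (measurableSet_ball.prod measurableSet_Ioo)
              fun z hz => ENNReal.ofReal_le_ofReal ?_
            rw [hζone z.1 hz.1]
            linarith
        _ ≤ ∫⁻ z in univ ×ˢ Ioo a b, ENNReal.ofReal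
              (2 * (1 / 2 * (derivF₀ h P (v z) * ‖D z‖ ^ 2 * ζ z.1 ^ 2))) :=
            lintegral_mono_set (prod_mono (subset_univ _) le_rfl)
        _ = ENNReal.ofReal (2 * ∫ τ in Ioo a b, g τ) := by
            rw [hg, ← integral_prod_symm _ iE', ← integral_const_mul,
              ofReal_integral_eq_lintegral_ofReal (iE'.const_mul 2)
              (ae_of_all _ fun z => mul_nonneg zero_le_two
                (mul_nonneg (by norm_num) (mul_nonneg (hE0 _) (sq_nonneg _)))),
              Measure.volume_eq_prod, ← Measure.prod_restrict, Measure.restrict_univ]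
        _ ≤ _ := ENNReal.ofReal_le_ofReal
            (mul_le_mul_of_nonneg_left (H2 a b ha hab hb) zero_le_two)
    have hU : ball x₀ ρ₂ ×ˢ Ioo 0 T' =
        ⋃ n : ℕ, ball x₀ ρ₂ ×ˢ Ioo (1 / ((n:ℝ) + 1)) (T' - 1 / ((n:ℝ) + 1)) := by
      ext z
      simp only [mem_iUnion, mem_prod]
      constructor
      · rintro ⟨h1, h2⟩
        obtain ⟨n, hn⟩ := exists_nat_one_div_lt (lt_min h2.1 (sub_pos.2 h2.2))
        have h3 := hn.trans_le (min_le_left _ _)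
        have h4 := hn.trans_le (min_le_right _ _)
        exact ⟨n, h1, h3, by linarith⟩
      · rintro ⟨n, h1, h2⟩
        have : 0 < 1 / ((n:ℝ) + 1) := by positivity
        exact ⟨h1, this.trans h2.1, by linarith [h2.2]⟩
    have hmono : Monotone fun n : ℕ =>
        ball x₀ ρ₂ ×ˢ Ioo (1 / ((n:ℝ) + 1)) (T' - 1 / ((n:ℝ) + 1)) := by
      intro i j hij
      have : 1 / ((j:ℝ) + 1) ≤ 1 / ((i:ℝ) + 1) := Nat.one_div_le_one_div hij
      exact prod_mono le_rfl (Ioo_subset_Ioo this (by linarith))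
    rw [hU, setLIntegral_iUnion_of_directed _ hmono.directed_le]
    refine iSup_le fun n => (hstep _ _ (by positivity) ?_).trans ?_
    · have : 0 < 1 / ((n:ℝ) + 1) := by positivity
      linarith
    · rw [ENNReal.ofReal_mul zero_le_two, hQ, ENNReal.ofReal_mul zero_le_two, mul_assoc]

end IsBorelSolution

/-! ### The iteration -/

/-- Either `a` is below the level `τ`, or `b` is far from `a`, or both `a` and `b` exceed `τ / 2`;
the three terms on the right cover the three cases. -/
lemma sq_le_interpolation {a b K τ lam : ℝ} (ha : 0 ≤ a) (haK : a ≤ K) (hb : 0 ≤ b) (hτ : 0 < τ)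
    (hlam : 0 < lam) (hlam2 : lam < 2) :
    a ^ 2 ≤ τ ^ (2 - lam) * a ^ lam + 4 * (b - a) ^ 2
      + K ^ 2 * 2 ^ lam / (τ ^ lam) ^ 2 * (a ^ lam * b ^ lam) := by
  have t1 : 0 ≤ τ ^ (2 - lam) * a ^ lam := by positivity
  have t2 : 0 ≤ 4 * (b - a) ^ 2 := by positivity
  have t3 : 0 ≤ K ^ 2 * 2 ^ lam / (τ ^ lam) ^ 2 * (a ^ lam * b ^ lam) := by positivity
  rcases eq_or_lt_of_le ha with rfl | ha0
  · rw [zero_pow two_ne_zero]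
    positivity
  rcases le_or_gt a τ with haτ | haτ
  · have e : a ^ 2 = a ^ (2 - lam) * a ^ lam := by
      rw [← Real.rpow_add ha0, sub_add_cancel, Real.rpow_two]
    have : a ^ (2 - lam) ≤ τ ^ (2 - lam) := Real.rpow_le_rpow ha haτ (by linarith)
    have := mul_le_mul_of_nonneg_right this (Real.rpow_nonneg ha lam)
    linarith
  rcases le_or_gt b (a / 2) with hba | hba
  · nlinarith
  · have e1 : 1 ≤ (a / τ) ^ lam := Real.one_le_rpow ((one_le_div hτ).2 haτ.le) hlam.le
    have e2 : 1 ≤ (2 * b / τ) ^ lam :=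
      Real.one_le_rpow ((one_le_div hτ).2 (by linarith)) hlam.le
    have e3 : K ^ 2 * 2 ^ lam / (τ ^ lam) ^ 2 * (a ^ lam * b ^ lam)
        = K ^ 2 * ((a / τ) ^ lam * (2 * b / τ) ^ lam) := by
      rw [Real.div_rpow ha hτ.le, Real.div_rpow (by positivity) hτ.le,
        Real.mul_rpow zero_le_two hb]
      field_simp
    have e4 : 1 ≤ (a / τ) ^ lam * (2 * b / τ) ^ lam := one_le_mul_of_one_le_of_one_le e1 e2
    have e5 : a ^ 2 ≤ K ^ 2 := pow_le_pow_left₀ ha haK 2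
    have e6 := mul_le_mul_of_nonneg_left e4 (sq_nonneg K)
    rw [e3]
    linarith

/-- A nonlinear recursion with a free radius `r`: choosing `r` geometrically decreasing makes the
first term a contraction, and a small factor `κ` then keeps the superlinear term below it. -/
lemma exists_forall_tendsto_zero {A d B : ℝ} (hA : 0 < A) (hd : 0 < d) (hB : 0 ≤ B) (k : ℕ) :
    ∃ κ₀ > 0, ∀ κ, 0 < κ → κ ≤ κ₀ → ∀ y : ℕ → ℝ, (∀ n, 0 ≤ y n) → y 0 ≤ B →
      (∀ n r, 0 < r → r ≤ 1 → r ≤ d / 2 ^ n →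
        y (n + 1) ≤ A * 4 ^ n * y n * (r ^ 2 + κ * (r ^ k)⁻¹ * 4 ^ n * y n)) →
      Tendsto y atTop (𝓝 0) := by
  set q : ℝ := (16 * 2 ^ k)⁻¹ with hq
  have hq0 : 0 < q := by positivity
  have hq1 : q < 1 := by
    have : (1:ℝ) ≤ 2 ^ k := one_le_pow₀ one_le_two
    exact inv_lt_one_of_one_lt₀ (by linarith)
  set r₀ : ℝ := min (min 1 d) (q / (2 * A)) with hr₀
  have hr0 : 0 < r₀ := lt_min (lt_min one_pos hd) (by positivity)
  have hr1 : r₀ ≤ 1 := (min_le_left _ _).trans (min_le_left _ _)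
  have hrd : r₀ ≤ d := (min_le_left _ _).trans (min_le_right _ _)
  have hrA : A * r₀ ^ 2 ≤ q / 2 := by
    have h1 : r₀ ≤ q / (2 * A) := min_le_right _ _
    rw [le_div_iff₀ (by positivity)] at h1
    nlinarith
  refine ⟨q * r₀ ^ k / (2 * A * (B + 1)), by positivity, fun κ hκ0 hκ y hy0 hyB hrec => ?_⟩
  have hκA : A * κ * (r₀ ^ k)⁻¹ * B ≤ q / 2 := by
    rw [le_div_iff₀ (by positivity)] at hκ
    rw [mul_assoc, mul_comm (r₀ ^ k)⁻¹, ← mul_assoc, ← div_eq_mul_inv,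
      div_le_iff₀ (by positivity)]
    nlinarith [mul_pos hA hκ0]
  have hind : ∀ n, y n ≤ q ^ n * B := by
    intro n
    induction n with
    | zero => simpa using hyB
    | succ n ih =>
      have h2n : (1:ℝ) ≤ 2 ^ n := one_le_pow₀ one_le_two
      have step := hrec n (r₀ / 2 ^ n) (by positivity)
        ((div_le_self hr0.le h2n).trans hr1) (by gcongr)
      have e1 : A * 4 ^ n * y n * ((r₀ / 2 ^ n) ^ 2 + κ * ((r₀ / 2 ^ n) ^ k)⁻¹ * 4 ^ n * y n)
          = y n * (A * r₀ ^ 2 + A * κ * (r₀ ^ k)⁻¹ * ((q⁻¹) ^ n * y n)) := by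
        have h4 : (4:ℝ) ^ n = (2 ^ n) ^ 2 := by
          rw [← pow_mul, mul_comm, pow_mul]
          norm_num
        have hqn : (q⁻¹) ^ n = (2 ^ n) ^ 4 * (2 ^ n) ^ k := by
          rw [hq, inv_inv, mul_pow, ← pow_mul 2 k n, ← pow_mul 2 n k, mul_comm k n,
            ← pow_mul 2 n 4, mul_comm n 4, pow_mul 2 4 n]
          norm_num
        rw [hqn, h4, div_pow, div_pow, inv_div]
        field_simp
      have e2 : (q⁻¹) ^ n * y n ≤ B := by
        rw [inv_pow, inv_mul_le_iff₀ (by positivity)]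
        exact ih
      have e3 : A * κ * (r₀ ^ k)⁻¹ * ((q⁻¹) ^ n * y n) ≤ A * κ * (r₀ ^ k)⁻¹ * B :=
        mul_le_mul_of_nonneg_left e2 (by positivity)
      rw [e1] at step
      have e4 : y n * (A * r₀ ^ 2 + A * κ * (r₀ ^ k)⁻¹ * ((q⁻¹) ^ n * y n)) ≤ y n * q :=
        mul_le_mul_of_nonneg_left (by linarith) (hy0 n)
      calc y (n + 1) ≤ y n * q := step.trans e4
        _ ≤ q ^ n * B * q := mul_le_mul_of_nonneg_right ih hq0.le
        _ = q ^ (n + 1) * B := by ring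
  refine squeeze_zero hy0 hind ?_
  simpa using (tendsto_pow_atTop_nhds_zero_of_lt_one hq0.le hq1).mul_const B

section Averages

variable {N : ℕ} {W : EuclideanSpace ℝ (Fin N) × ℝ → ENNReal} {x₀ : EuclideanSpace ℝ (Fin N)}
  {ρ r T' : ℝ} {E₁ : ENNReal}

lemma lintegral_cylinder_le (hW : Measurable W) (B : Set (EuclideanSpace ℝ (Fin N)))
    (hE : ∀ᵐ t ∂(volume.restrict (Ioo 0 T')), ∫⁻ x in B, W (x, t) ≤ E₁) :
    ∫⁻ z in B ×ˢ Ioo 0 T', W z ≤ ENNReal.ofReal T' * E₁ := by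
  rw [Measure.volume_eq_prod, ← Measure.prod_restrict, lintegral_prod_symm _ hW.aemeasurable]
  refine (lintegral_mono_ae hE).trans ?_
  rw [lintegral_const, Measure.restrict_apply_univ, Real.volume_Ioo, sub_zero, mul_comm]

lemma lintegral_translate_mul_le (hW : Measurable W)
    (hE : ∀ᵐ t ∂(volume.restrict (Ioo 0 T')), ∫⁻ x in ball x₀ (ρ + r), W (x, t) ≤ E₁)
    (hr : 0 ≤ r) :
    ∫⁻ y in ball (0 : EuclideanSpace ℝ (Fin N)) r, ∫⁻ z in ball x₀ ρ ×ˢ Ioo 0 T',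
      W z * W (z + (y, 0)) ≤ ENNReal.ofReal T' * E₁ ^ 2 := by
  have hm : Measurable fun a : EuclideanSpace ℝ (Fin N) × (EuclideanSpace ℝ (Fin N) × ℝ) =>
      W (a.2 + (a.1, 0)) :=
    hW.comp (measurable_snd.add (measurable_fst.prodMk measurable_const))
  rw [lintegral_lintegral_swap ((hW.comp measurable_snd).mul hm).aemeasurable]
  have hE' : ∀ᵐ z ∂(volume.restrict (ball x₀ ρ ×ˢ Ioo 0 T')),
      ∫⁻ y in ball (0 : EuclideanSpace ℝ (Fin N)) r, W z * W (z + (y, 0)) ≤ W z * E₁ := by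
    have h1 : ∀ᵐ z ∂(volume.restrict (ball x₀ ρ ×ˢ Ioo 0 T')),
        ∫⁻ x in ball x₀ (ρ + r), W (x, z.2) ≤ E₁ := by
      rw [Measure.volume_eq_prod, ← Measure.prod_restrict]
      exact Measure.quasiMeasurePreserving_snd.ae hE
    filter_upwards [h1, ae_restrict_mem (measurableSet_ball.prod measurableSet_Ioo)] with z hz hzm
    have hmy : Measurable fun y : EuclideanSpace ℝ (Fin N) => W (z + (y, 0)) :=
      hW.comp (measurable_const.add (measurable_id.prodMk measurable_const))
    rw [lintegral_const_mul _ hmy]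
    refine mul_le_mul_right (le_trans ?_ hz) _
    rw [← lintegral_indicator measurableSet_ball, ← lintegral_indicator measurableSet_ball,
      ← lintegral_add_left_eq_self ((ball x₀ (ρ + r)).indicator fun x => W (x, z.2)) z.1]
    refine lintegral_mono fun y => ?_
    by_cases hy : y ∈ ball (0 : EuclideanSpace ℝ (Fin N)) r
    · have : z.1 + y ∈ ball x₀ (ρ + r) := by
        have h2 := mem_ball.1 hzm.1
        have h3 := mem_ball_zero_iff.1 hy
        have h4 := dist_triangle (z.1 + y) z.1 x₀
        have h5 : dist (z.1 + y) z.1 = ‖y‖ := by simp [dist_eq_norm]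
        rw [mem_ball]
        linarith
      rw [indicator_of_mem hy, indicator_of_mem this]
      refine le_of_eq (congrArg W ?_)
      ext1 <;> simp
    · rw [indicator_of_notMem hy]
      exact zero_le
  refine (lintegral_mono_ae hE').trans ?_
  rw [lintegral_mul_const _ hW, sq, ← mul_assoc]
  refine mul_le_mul_left (lintegral_cylinder_le hW _ ?_) _
  filter_upwards [hE] with t ht
  exact (lintegral_mono_set (ball_subset_ball (by linarith))).trans ht

end Averages

namespace IsBorelSolution

variable {N : ℕ} {h P : ℝ → ℝ} {S : Set (EuclideanSpace ℝ (Fin N))} {T M : ℝ}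
  {v : EuclideanSpace ℝ (Fin N) × ℝ → ℝ}
  {D : EuclideanSpace ℝ (Fin N) × ℝ → EuclideanSpace ℝ (Fin N)}

/-- The interpolation inequality replacing that of Gagliardo and Nirenberg: the `L²` norm of `G(v)`
on a small cylinder is bounded by the mass and the energy on a larger one, with a free level `τ`
and a free averaging radius `r`. -/
lemma interpolation (hS : IsBorelSolution h P S T M v D) (hP : IsCoefficientPair h P)
    {lam τ ρ r T' : ℝ} {x₀ : EuclideanSpace ℝ (Fin N)} {E₁ E₂ : ENNReal} (hτ : 0 < τ)
    (hlam : 0 < lam) (hlam2 : lam < 2) (hr : 0 ≤ r) (hT' : T' ≤ T)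
    (hρ : closedBall x₀ (ρ + r) ⊆ S)
    (hE₁ : ∀ᵐ t ∂(volume.restrict (Ioo 0 T')),
      ∫⁻ x in ball x₀ (ρ + r), ENNReal.ofReal (G h P (v (x, t)) ^ lam) ≤ E₁)
    (hE₂ : ∫⁻ z in ball x₀ (ρ + r) ×ˢ Ioo 0 T',
      ENNReal.ofReal (derivF₀ h P (v z) * ‖D z‖ ^ 2) ≤ E₂) :
    (∫⁻ z in ball x₀ ρ ×ˢ Ioo 0 T', ENNReal.ofReal (G h P (v z) ^ 2)) *
        volume (ball (0 : EuclideanSpace ℝ (Fin N)) r) ≤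
      (ENNReal.ofReal (τ ^ (2 - lam)) * (ENNReal.ofReal T' * E₁)
        + ENNReal.ofReal 4 * (ENNReal.ofReal (r ^ 2) * E₂)) *
          volume (ball (0 : EuclideanSpace ℝ (Fin N)) r)
      + ENNReal.ofReal (G h P M ^ 2 * 2 ^ lam / (τ ^ lam) ^ 2) *
          (ENNReal.ofReal T' * E₁ ^ 2) := by
  set κ := G h P M ^ 2 * 2 ^ lam / (τ ^ lam) ^ 2 with hκ
  have hκ0 : 0 ≤ κ := by positivity
  have mG := measurable_G_comp hP hS.measurable_v hS.mem_Icc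
  set W : EuclideanSpace ℝ (Fin N) × ℝ → ENNReal := fun z =>
    ENNReal.ofReal (G h P (v z) ^ lam) with hWdef
  have hW : Measurable W := ENNReal.measurable_ofReal.comp (mG.pow_const lam)
  have hWρ : ∫⁻ z in ball x₀ ρ ×ˢ Ioo 0 T', W z ≤ ENNReal.ofReal T' * E₁ := by
    refine lintegral_cylinder_le hW _ ?_
    filter_upwards [hE₁] with t ht
    exact (lintegral_mono_set (ball_subset_ball (by linarith))).trans ht
  have hpt : ∀ y z, ENNReal.ofReal (G h P (v z) ^ 2) ≤
      ENNReal.ofReal (τ ^ (2 - lam)) * W z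
        + ENNReal.ofReal 4 * ENNReal.ofReal ((G h P (v (z + (y, 0))) - G h P (v z)) ^ 2)
        + ENNReal.ofReal κ * (W z * W (z + (y, 0))) := by
    intro y z
    have h0 := hS.G_comp_bounds hP z
    have h1 := hS.G_comp_bounds hP (z + (y, 0))
    have h2 := Real.rpow_nonneg h0.1 lam
    have h3 := Real.rpow_nonneg h1.1 lam
    have h4 := Real.rpow_nonneg hτ.le (2 - lam)
    rw [hWdef]
    simp only
    rw [← ENNReal.ofReal_mul h4, ← ENNReal.ofReal_mul zero_le_four, ← ENNReal.ofReal_mul h2,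
      ← ENNReal.ofReal_mul hκ0, ← ENNReal.ofReal_add (by positivity) (by positivity),
      ← ENNReal.ofReal_add (by positivity) (by positivity)]
    exact ENNReal.ofReal_le_ofReal (sq_le_interpolation h0.1 h0.2 h1.1 hτ hlam hlam2)
  have hy : ∀ y ∈ ball (0 : EuclideanSpace ℝ (Fin N)) r,
      ∫⁻ z in ball x₀ ρ ×ˢ Ioo 0 T', ENNReal.ofReal (G h P (v z) ^ 2) ≤
      (ENNReal.ofReal (τ ^ (2 - lam)) * (ENNReal.ofReal T' * E₁)
        + ENNReal.ofReal 4 * (ENNReal.ofReal (r ^ 2) * E₂))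
      + ENNReal.ofReal κ * ∫⁻ z in ball x₀ ρ ×ˢ Ioo 0 T', W z * W (z + (y, 0)) := by
    intro y hy
    have mt : Measurable fun z : EuclideanSpace ℝ (Fin N) × ℝ => z + (y, 0) :=
      measurable_add_const _
    have m2 : Measurable fun z =>
        ENNReal.ofReal ((G h P (v (z + (y, 0))) - G h P (v z)) ^ 2) :=
      ENNReal.measurable_ofReal.comp (((mG.comp mt).sub mG).pow_const 2)
    have m3 : Measurable fun z => W z * W (z + (y, 0)) := hW.mul (hW.comp mt)
    refine (lintegral_mono (hpt y)).trans ?_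
    rw [lintegral_add_right _ (m3.const_mul _), lintegral_add_right _ (m2.const_mul _),
      lintegral_const_mul _ hW, lintegral_const_mul _ m2, lintegral_const_mul _ m3]
    gcongr
    refine (hS.lintegral_sq_G_translate_le hP hT' hρ (mem_ball_zero_iff.1 hy).le).trans ?_
    gcongr
  calc _ = ∫⁻ _y in ball (0 : EuclideanSpace ℝ (Fin N)) r,
        ∫⁻ z in ball x₀ ρ ×ˢ Ioo 0 T', ENNReal.ofReal (G h P (v z) ^ 2) := by
        rw [setLIntegral_const]
    _ ≤ ∫⁻ y in ball (0 : EuclideanSpace ℝ (Fin N)) r,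
        ((ENNReal.ofReal (τ ^ (2 - lam)) * (ENNReal.ofReal T' * E₁)
          + ENNReal.ofReal 4 * (ENNReal.ofReal (r ^ 2) * E₂))
        + ENNReal.ofReal κ * ∫⁻ z in ball x₀ ρ ×ˢ Ioo 0 T', W z * W (z + (y, 0))) :=
        setLIntegral_mono' measurableSet_ball hy
    _ = _ + ENNReal.ofReal κ * ∫⁻ y in ball (0 : EuclideanSpace ℝ (Fin N)) r,
          ∫⁻ z in ball x₀ ρ ×ˢ Ioo 0 T', W z * W (z + (y, 0)) := by
        rw [lintegral_add_left measurable_const, setLIntegral_const,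
          lintegral_const_mul' _ _ ENNReal.ofReal_ne_top]
    _ ≤ _ := by
        gcongr
        exact lintegral_translate_mul_le hW hE₁ hr

end IsBorelSolution

/-- The arithmetic turning the interpolation inequality and the energy estimate into one step of
the recursion; `s`, `a`, `b` stand for powers of the level and of the radius. -/
lemma recursion_step {y y' r t C₂ c₀ Q s a b β X : ℝ} (ht1 : t ≤ 1)
    (hC₂ : 0 ≤ C₂) (hc₀ : 0 ≤ c₀) (hQ : 0 ≤ Q) (ha : 0 < a) (hb : 0 < b) (hbs : b ≤ s)
    (hβ : 0 < β) (hX : 0 ≤ X) (hy : 0 ≤ y) (ht : 0 ≤ t)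
    (hstep : y' * (a * β) ≤ (r ^ 2 * (t * (C₂ * (c₀ * X) * y))
      + 4 * (r ^ 2 * (2 * (c₀ * X) * y))) * (a * β) + Q / s * (t * (C₂ * (c₀ * X) * y) ^ 2)) :
    y' ≤ (c₀ * (C₂ + 8) + Q * (C₂ * c₀) ^ 2 / β + 1) * X * y *
      (r ^ 2 + t * (a * b)⁻¹ * X * y) := by
  have haβ : 0 < a * β := mul_pos ha hβ
  have h1 : y' ≤ r ^ 2 * (t * (C₂ * (c₀ * X) * y)) + 4 * (r ^ 2 * (2 * (c₀ * X) * y))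
      + Q / s * (t * (C₂ * (c₀ * X) * y) ^ 2) / (a * β) := by
    rw [← le_div_iff₀ haβ] at hstep
    refine hstep.trans (le_of_eq ?_)
    rw [add_div, mul_div_cancel_right₀ _ haβ.ne']
  have h2 : Q / s * (t * (C₂ * (c₀ * X) * y) ^ 2) / (a * β)
      ≤ Q / b * (t * (C₂ * (c₀ * X) * y) ^ 2) / (a * β) := by
    gcongr
  have e2 : Q / b * (t * (C₂ * (c₀ * X) * y) ^ 2) / (a * β)
      = Q * (C₂ * c₀) ^ 2 / β * X * y * (t * (a * b)⁻¹ * X * y) := by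
    field_simp
  have h3 : r ^ 2 * (t * (C₂ * (c₀ * X) * y)) ≤ r ^ 2 * (C₂ * (c₀ * X) * y) :=
    mul_le_mul_of_nonneg_left (mul_le_of_le_one_left (by positivity) ht1) (sq_nonneg r)
  set p := t * (a * b)⁻¹ * X * y with hp
  have hp0 : 0 ≤ p := by positivity
  set k := Q * (C₂ * c₀) ^ 2 / β with hk
  have hk0 : 0 ≤ k := by positivity
  have h4 : 0 ≤ X * y * (r ^ 2 * (k + 1) + p * (c₀ * (C₂ + 8) + 1)) := by positivity
  rw [e2] at h2
  nlinarith

namespace IsBorelSolution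

variable {N : ℕ} {h P : ℝ → ℝ} {S : Set (EuclideanSpace ℝ (Fin N))} {T M : ℝ}
  {v : EuclideanSpace ℝ (Fin N) × ℝ → ℝ}
  {D : EuclideanSpace ℝ (Fin N) × ℝ → EuclideanSpace ℝ (Fin N)}

/-- A bounded solution with zero initial values vanishes in a smaller ball for a short time. -/
theorem exists_ae_eq_zero (hS : IsBorelSolution h P S T M v D) (hP : IsCoefficientPair h P)
    (hT : 0 < T) (hA1 : AssumptionA1 h P M) (hA2 : AssumptionA2 h P M)
    {x₀ : EuclideanSpace ℝ (Fin N)} {R R' : ℝ} (hR : closedBall x₀ R ⊆ S) (hRR' : R' < R) :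
    ∃ T', 0 < T' ∧ T' ≤ T ∧ ∀ᵐ z ∂(volume.restrict (ball x₀ R' ×ˢ Ioo 0 T')), v z = 0 := by
  obtain ⟨C₁, hC₁, hA1⟩ := hA1
  obtain ⟨C₂, hC₂, lam, hlam, hlam2, hA2⟩ := hA2
  set d := (R - R') / 2 with hd
  have hd0 : 0 < d := by rw [hd]; linarith
  set β := volume.real (ball (0 : EuclideanSpace ℝ (Fin N)) 1) with hβ
  have hβ0 : 0 < β := ENNReal.toReal_pos (measure_ball_pos _ _ one_pos).ne' measure_ball_lt_top.ne
  set c₀ := 32 * C₁ ^ 2 / d ^ 2 with hc₀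
  have hc₀0 : 0 ≤ c₀ := by positivity
  set Q := G h P M ^ 2 * 2 ^ lam with hQ
  have hQ0 : 0 ≤ Q := by positivity
  obtain ⟨k, hk⟩ := exists_nat_ge (4 * lam / (2 - lam))
  set A := c₀ * (C₂ + 8) + Q * (C₂ * c₀) ^ 2 / β + 1 with hA
  have hA0 : 0 < A := by positivity
  set B := G h P M ^ 2 * volume.real (ball x₀ R) with hB
  obtain ⟨κ₀, hκ₀, hiter⟩ := exists_forall_tendsto_zero hA0 (d := d / 4) (by positivity)
    (B := B) (by positivity) (N + k)
  set T' := min (min 1 T) κ₀ with hT'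
  have hT'0 : 0 < T' := lt_min (lt_min one_pos hT) hκ₀
  have hT'1 : T' ≤ 1 := (min_le_left _ _).trans (min_le_left _ _)
  have hT'T : T' ≤ T := (min_le_left _ _).trans (min_le_right _ _)
  refine ⟨T', hT'0, hT'T, ?_⟩
  have mG := measurable_G_comp hP hS.measurable_v hS.mem_Icc
  set ρ : ℕ → ℝ := fun n => R' + d / 2 ^ n with hρ
  have hρR : ∀ n, ρ n ≤ R := fun n => by
    have : d / 2 ^ n ≤ d := div_le_self hd0.le (one_le_pow₀ one_le_two)
    simp only [hρ]
    linarith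
  set Y : ℕ → ENNReal := fun n =>
    ∫⁻ z in ball x₀ (ρ n) ×ˢ Ioo 0 T', ENNReal.ofReal (G h P (v z) ^ 2) with hY
  have hYB : ∀ n, Y n ≤ ENNReal.ofReal B := by
    intro n
    calc Y n ≤ ∫⁻ _z in ball x₀ R ×ˢ Ioo 0 T', ENNReal.ofReal (G h P M ^ 2) := by
          refine (lintegral_mono fun z => ENNReal.ofReal_le_ofReal (pow_le_pow_left₀
            (hS.G_comp_bounds hP z).1 (hS.G_comp_bounds hP z).2 2)).trans
            (lintegral_mono_set (prod_mono (ball_subset_ball (hρR n)) le_rfl))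
      _ ≤ ENNReal.ofReal (G h P M ^ 2) * volume (ball x₀ R) := by
          rw [setLIntegral_const, Measure.volume_eq_prod, Measure.prod_prod, Real.volume_Ioo]
          refine mul_le_mul_right (mul_le_of_le_one_right zero_le ?_) _
          rw [ENNReal.ofReal_le_one]
          linarith
      _ = ENNReal.ofReal B := by
          rw [hB, ENNReal.ofReal_mul (sq_nonneg _), ofReal_measureReal measure_ball_lt_top.ne]
  have hYtop : ∀ n, Y n ≠ ⊤ := fun n => ((hYB n).trans_lt ENNReal.ofReal_lt_top).ne
  have hYreal : ∀ n, Y n = ENNReal.ofReal (Y n).toReal := fun n =>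
    (ENNReal.ofReal_toReal (hYtop n)).symm
  have hlim : Tendsto (fun n => (Y n).toReal) atTop (𝓝 0) := by
    refine hiter T' hT'0 (min_le_right _ _) _ (fun n => ENNReal.toReal_nonneg)
      (ENNReal.toReal_le_of_le_ofReal (by positivity) (hYB 0)) ?_
    intro n r hr0 hr1 hrd
    set L := 2 ^ (n + 2) / d with hL
    have hgap : ρ n - (ρ (n + 1) + r) ≥ d / 2 ^ (n + 2) := by
      have e1 : d / 2 ^ n = 4 * (d / 2 ^ (n + 2)) := by
        rw [pow_add]; field_simp; norm_num
      have e2 : d / 2 ^ (n + 1) = 2 * (d / 2 ^ (n + 2)) := by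
        rw [pow_add, pow_add]; field_simp
      have e3 : d / 4 / 2 ^ n = d / 2 ^ (n + 2) := by
        rw [pow_add]; field_simp; norm_num
      rw [e3] at hrd
      simp only [hρ]
      rw [e1, e2]
      linarith
    have hL0 : 0 ≤ L := by positivity
    have hL1 : 1 ≤ L * (ρ n - (ρ (n + 1) + r)) := by
      refine le_trans (le_of_eq ?_) (mul_le_mul_of_nonneg_left hgap hL0)
      rw [hL]
      field_simp
    have hc : 2 * C₁ ^ 2 * L ^ 2 = c₀ * 4 ^ n := by
      have : (2:ℝ) ^ (n + 2) = 4 * 2 ^ n := by rw [pow_add]; ring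
      have h4 : (4:ℝ) ^ n = (2 ^ n) ^ 2 := by
        rw [← pow_mul, mul_comm, pow_mul]
        norm_num
      rw [hL, hc₀, h4, this]
      field_simp
      norm_num
    have hsub : closedBall x₀ (ρ n) ⊆ S := (closedBall_subset_closedBall (hρR n)).trans hR
    have hd2 : 0 < d / 2 ^ (n + 2) := by positivity
    have hsub' : closedBall x₀ (ρ (n + 1) + r) ⊆ S :=
      (closedBall_subset_closedBall (by linarith)).trans hsub
    obtain ⟨h1, h2⟩ := hS.energy_estimate hP hA1 hC₂ hlam hA2 hT'T hsub hL0 hL1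
    -- the level is chosen so that its contribution balances that of the averaging radius
    set τ := r ^ (2 / (2 - lam)) with hτ
    have hτ0 : 0 < τ := Real.rpow_pos_of_pos hr0 _
    have hlam' : 0 < 2 - lam := by linarith
    have hτ1 : τ ^ (2 - lam) = r ^ 2 := by
      rw [hτ, ← Real.rpow_mul hr0.le, div_mul_cancel₀ _ hlam'.ne', Real.rpow_two]
    have hτ2 : r ^ k ≤ (τ ^ lam) ^ 2 := by
      rw [hτ, ← Real.rpow_natCast, ← Real.rpow_natCast, ← Real.rpow_mul hr0.le,
        ← Real.rpow_mul hr0.le]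
      refine Real.rpow_le_rpow_of_exponent_ge hr0 hr1 (le_trans (le_of_eq ?_) hk)
      push_cast
      field_simp
      norm_num
    have key := hS.interpolation hP hτ0 hlam hlam2 hr0.le hT'T hsub' h1 h2
    change Y (n + 1) * _ ≤ _ at key
    change _ ≤ (_ * (_ * (_ * Y n)) + _ * (_ * (_ * Y n))) * _ + _ * (_ * (_ * Y n) ^ 2) at key
    have hvol : volume (ball (0 : EuclideanSpace ℝ (Fin N)) r) = ENNReal.ofReal (r ^ N * β) := by
      have := Measure.addHaar_ball_of_pos (volume : Measure (EuclideanSpace ℝ (Fin N))) 0 hr0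
      rw [finrank_euclideanSpace_fin] at this
      rw [this, ENNReal.ofReal_mul (by positivity), hβ, ofReal_measureReal measure_ball_lt_top.ne]
    have hyn : 0 ≤ (Y n).toReal := ENNReal.toReal_nonneg
    have hyn' : 0 ≤ (Y (n + 1)).toReal := ENNReal.toReal_nonneg
    rw [hvol, hYreal n, hYreal (n + 1), hc, hτ1] at key
    rw [← ENNReal.ofReal_mul hyn', ← ENNReal.ofReal_mul (by positivity),
      ← ENNReal.ofReal_mul (by positivity), ← ENNReal.ofReal_mul (by positivity),
      ← ENNReal.ofReal_mul (by positivity), ← ENNReal.ofReal_mul (by positivity),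
      ← ENNReal.ofReal_mul (by positivity), ← ENNReal.ofReal_add (by positivity) (by positivity),
      ← ENNReal.ofReal_mul (by positivity), ← ENNReal.ofReal_pow (by positivity),
      ← ENNReal.ofReal_mul (by positivity), ← ENNReal.ofReal_mul (by positivity),
      ← ENNReal.ofReal_add (by positivity) (by positivity),
      ENNReal.ofReal_le_ofReal_iff (by positivity)] at key
    rw [pow_add]
    exact recursion_step hT'1 hC₂.le hc₀0 hQ0 (by positivity) (by positivity) hτ2 hβ0
      (by positivity) hyn hT'0.le key
  have hzero : ∫⁻ z in ball x₀ R' ×ˢ Ioo 0 T', ENNReal.ofReal (G h P (v z) ^ 2) = 0 := by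
    set I := ∫⁻ z in ball x₀ R' ×ˢ Ioo 0 T', ENNReal.ofReal (G h P (v z) ^ 2) with hI
    have hle : ∀ n, I ≤ Y n := fun n => by
      refine lintegral_mono_set (prod_mono (ball_subset_ball ?_) le_rfl)
      have : 0 < d / 2 ^ n := by positivity
      simp only [hρ]
      linarith
    have hIt : I ≠ ⊤ := ((hle 0).trans_lt (hYtop 0).lt_top).ne
    have : I.toReal ≤ 0 := ge_of_tendsto' hlim fun n => ENNReal.toReal_mono (hYtop n) (hle n)
    have h0 : I.toReal = 0 := le_antisymm this ENNReal.toReal_nonneg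
    exact ((ENNReal.toReal_eq_zero_iff _).1 h0).resolve_right hIt
  have hGm : Measurable fun z => ENNReal.ofReal (G h P (v z) ^ 2) :=
    ENNReal.measurable_ofReal.comp (mG.pow_const 2)
  rw [lintegral_eq_zero_iff hGm] at hzero
  filter_upwards [hzero] with z hz
  by_contra hne
  have hpos : 0 < v z := lt_of_le_of_ne (hS.mem_Icc z).1 (Ne.symm hne)
  have hG : G h P (v z) = 0 := by
    have h1 : G h P (v z) ^ 2 ≤ 0 := ENNReal.ofReal_eq_zero.1 hz
    exact pow_eq_zero_iff two_ne_zero |>.1 (le_antisymm h1 (sq_nonneg _))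
  have h2 := hA1 _ (hS.mem_Icc z)
  rw [hG, mul_zero, mul_zero] at h2
  exact absurd (hP.F_pos hpos) (not_lt.2 h2)

end IsBorelSolution

/-! ### Passage from weak solutions to Borel representatives -/

lemma aestronglyMeasurable_of_integrableOn_compact {N : ℕ} {Y : Type*} [NormedAddCommGroup Y]
    {U : Set (EuclideanSpace ℝ (Fin N) × ℝ)} (hU : IsOpen U)
    {f : EuclideanSpace ℝ (Fin N) × ℝ → Y} (hf : ∀ K ⊆ U, IsCompact K → IntegrableOn f K) :
    AEStronglyMeasurable f (volume.restrict U) :=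
  ((locallyIntegrableOn_iff hU.isLocallyClosed).2 hf).aestronglyMeasurable

lemma setIntegral_eq_integral_of_ae_eq {α : Type*} [MeasurableSpace α] {μ : Measure α}
    {U V : Set α} (hU : MeasurableSet U) (hUV : U ⊆ V) {f g : α → ℝ}
    (hfg : ∀ᵐ z ∂(μ.restrict U), f z = g z) (hf : ∀ z, z ∉ U → f z = 0)
    (hg : ∀ z, z ∉ U → g z = 0) : ∫ z in V, f z ∂μ = ∫ z, g z ∂μ := by
  rw [setIntegral_eq_integral_of_forall_compl_eq_zero fun z hz => hf z fun hh => hz (hUV hh)]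
  refine integral_congr_ae ?_
  rw [ae_restrict_iff' hU] at hfg
  filter_upwards [hfg] with z hz
  by_cases h : z ∈ U
  · exact hz h
  · rw [hf z h, hg z h]

lemma gradient_of_notMem_tsupport {N : ℕ} {θ : EuclideanSpace ℝ (Fin N) → ℝ}
    {x : EuclideanSpace ℝ (Fin N)} (hx : x ∉ tsupport θ) : gradient θ x = 0 := by
  rw [gradient, fderiv_of_notMem_tsupport ℝ hx, map_zero]

/-- A weak solution that is at most `M` and vanishes initially on an open set `S` agrees almost
everywhere on `S × (0, T)` with a Borel solution. -/
lemma IsWeakSolution.exists_isBorelSolution {N : ℕ} {h P : ℝ → ℝ}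
    {Ω S : Set (EuclideanSpace ℝ (Fin N))} (hS : IsOpen S) (hsub : S ⊆ Ω) {T M : ℝ} (hT : 0 < T)
    (hM : 0 < M) {u : EuclideanSpace ℝ (Fin N) → ℝ → ℝ} (hu : IsWeakSolution h P Ω T u)
    (hu0 : ∀ x ∈ S, u x 0 = 0)
    (huM : ∀ᵐ z ∂(volume.restrict (S ×ˢ Ioo 0 T)), u z.1 z.2 ≤ M) :
    ∃ v D, IsBorelSolution h P S T M v D ∧
      ∀ᵐ z ∂(volume.restrict (S ×ˢ Ioo 0 T)), v z = u z.1 z.2 := by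
  obtain ⟨Du, hDu, hweak, hgrad, hineq⟩ := hu.ineq
  set U := S ×ˢ Ioo 0 T with hUdef
  have hUo : IsOpen U := hS.prod isOpen_Ioo
  have hUm : MeasurableSet U := hUo.measurableSet
  have hUΩ : U ⊆ Ω ×ˢ Ioo 0 T := prod_mono hsub le_rfl
  have hUΩ' : U ⊆ Ω ×ˢ Ioc 0 T := prod_mono hsub Ioo_subset_Ioc_self
  have hum : AEStronglyMeasurable (fun z : EuclideanSpace ℝ (Fin N) × ℝ => u z.1 z.2)
      (volume.restrict U) := by
    refine aestronglyMeasurable_of_integrableOn_compact hUo fun K hK hKc => ?_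
    have : IsFiniteMeasure (volume.restrict K) :=
      ⟨by rw [Measure.restrict_apply_univ]; exact hKc.measure_lt_top⟩
    exact (hu.locBdd K (hK.trans (prod_mono hsub Ioo_subset_Icc_self)) hKc).integrable le_top
  have hDi : ∀ K ⊆ U, IsCompact K → IntegrableOn Du K := fun K hK hKc => by
    have : IsFiniteMeasure (volume.restrict K) :=
      ⟨by rw [Measure.restrict_apply_univ]; exact hKc.measure_lt_top⟩
    exact (hDu K (hK.trans hUΩ') hKc).integrable one_le_two
  have hDm := aestronglyMeasurable_of_integrableOn_compact hUo hDi
  set v : EuclideanSpace ℝ (Fin N) × ℝ → ℝ := fun z => max 0 (min M (hum.mk _ z)) with hv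
  set D := hDm.mk _ with hD
  have hvm : Measurable v :=
    measurable_const.max (measurable_const.min hum.stronglyMeasurable_mk.measurable)
  have hvu : ∀ᵐ z ∂(volume.restrict U), v z = u z.1 z.2 := by
    filter_upwards [hum.ae_eq_mk, huM, ae_restrict_mem hUm] with z h1 h2 h3
    rw [hv]
    simp only
    rw [← h1, min_eq_right h2,
      max_eq_right (hu.nonneg z.1 (hsub h3.1) z.2 (Ioo_subset_Icc_self h3.2))]
  have hDD : ∀ᵐ z ∂(volume.restrict U), D z = Du z := by
    filter_upwards [hDm.ae_eq_mk] with z h1 using h1.symm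
  have hgG : ∀ᵐ z ∂(volume.restrict U), gradGSq h P u Du z = derivF₀ h P (v z) * ‖D z‖ ^ 2 := by
    filter_upwards [hvu, hDD] with z h1 h2
    rw [h1, h2, gradGSq, derivF₀]
    split_ifs <;> simp
  refine ⟨v, D, ?_, hvu⟩
  refine
    { measurable_v := hvm
      mem_Icc := fun z => ⟨le_max_left _ _, max_le hM.le (min_le_left _ _)⟩
      measurable_D := hDm.stronglyMeasurable_mk.measurable
      integrableOn_D := fun K hK hKc => (hDi K hK hKc).congr ?_
      integrableOn_energy := fun K hK hKc =>
        (memLp_one_iff_integrable.1 (hgrad K (hK.trans hUΩ') hKc)).congr ?_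
      weak_gradient := fun y φ hφ hφc hφU => ?_
      weak_ineq := fun θ η hθL hθc hθS hθ0 hη hηc hηT hη0 => ?_
      initial := fun K hK hKc ε hε => ?_ }
  · filter_upwards [ae_restrict_of_ae_restrict_of_subset hK hDD] with z hz using hz.symm
  · exact ae_restrict_of_ae_restrict_of_subset hK hgG
  · have h1 := hweak y φ hφ hφc (hφU.trans hUΩ)
    have hφ0 : ∀ z, z ∉ U → φ z = 0 := fun z hz =>
      image_eq_zero_of_notMem_tsupport fun hh => hz (hφU hh)
    have hφ'0 : ∀ z, z ∉ U → fderiv ℝ φ z = 0 := fun z hz =>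
      fderiv_of_notMem_tsupport ℝ fun hh => hz (hφU hh)
    have e1 : ∫ z in Ω ×ˢ Ioo 0 T, u z.1 z.2 * fderiv ℝ φ z (y, 0)
        = ∫ z, v z * fderiv ℝ φ z (y, 0) := by
      refine setIntegral_eq_integral_of_ae_eq hUm hUΩ ?_ ?_ ?_
      · filter_upwards [hvu] with z hz
        rw [hz]
      all_goals
        intro z hz
        simp [hφ'0 z hz]
    have e2 : ∫ z in Ω ×ˢ Ioo 0 T, inner ℝ (Du z) y * φ z = ∫ z, inner ℝ (D z) y * φ z := by
      refine setIntegral_eq_integral_of_ae_eq hUm hUΩ ?_ ?_ ?_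
      · filter_upwards [hDD] with z hz
        rw [hz]
      all_goals
        intro z hz
        simp [hφ0 z hz]
    rw [← e1, ← e2]
    exact h1
  · have h1 := hineq θ η hθL hθc (hθS.trans hsub) hθ0 hη hηc hηT hη0
    have hoff : ∀ z : EuclideanSpace ℝ (Fin N) × ℝ, z ∉ U →
        (θ z.1 = 0 ∧ gradient θ z.1 = 0) ∨ (η z.2 = 0 ∧ deriv η z.2 = 0) := by
      intro z hz
      by_cases hzS : z.1 ∈ S
      · have : z.2 ∉ tsupport η := fun hh => hz ⟨hzS, hηT hh⟩
        refine Or.inr ⟨image_eq_zero_of_notMem_tsupport this, ?_⟩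
        exact Function.notMem_support.1 fun hh => this (support_deriv_subset hh)
      · have : z.1 ∉ tsupport θ := fun hh => hzS (hθS hh)
        exact Or.inl ⟨image_eq_zero_of_notMem_tsupport this, gradient_of_notMem_tsupport this⟩
    refine le_of_eq_of_le (setIntegral_eq_integral_of_ae_eq hUm hUΩ ?_ ?_ ?_).symm h1
    · filter_upwards [hvu, hDD, hgG] with z h2 h3 h4
      rw [h4, h2, h3]
    · intro z hz
      rcases hoff z hz with ⟨e1, e2⟩ | ⟨e1, e2⟩ <;> simp [e1, e2]
    · intro z hz
      rcases hoff z hz with ⟨e1, e2⟩ | ⟨e1, e2⟩ <;> simp [e1, e2]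
  · have h1 := hu.initial_trace K (hK.trans hsub) hKc (ENNReal.ofReal ε) (by simpa using hε)
    have h2 := h1.eventually (ge_mem_nhds (show (0 : ENNReal) < ENNReal.ofReal ε by simpa using hε))
    obtain ⟨s₁, hs₁, h3⟩ := mem_nhdsGT_iff_exists_Ioo_subset.1 h2
    have h4 : ∀ᵐ s ∂(volume.restrict (Ioo 0 T)), ∀ᵐ x ∂(volume.restrict S), v (x, s) = u x s := by
      have h5 := hvu
      rw [hUdef, Measure.volume_eq_prod, ← Measure.prod_restrict] at h5
      have h6 := Measure.measurePreserving_swap.quasiMeasurePreserving.ae h5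
      exact Measure.ae_ae_of_ae_prod h6
    refine ⟨min s₁ T, lt_min hs₁ hT, ?_⟩
    have h7 := ae_restrict_of_ae_restrict_of_subset
      (Ioo_subset_Ioo_right (min_le_right s₁ T) : Ioo 0 (min s₁ T) ⊆ Ioo 0 T) h4
    filter_upwards [h7, ae_restrict_mem measurableSet_Ioo] with s hs hsI
    have h8 := h3 ⟨hsI.1, hsI.2.trans_le (min_le_left _ _)⟩
    refine le_trans ?_ h8
    have hKm : MeasurableSet K := hKc.isClosed.measurableSet
    have e : {x ∈ K | ε ≤ v (x, s)} = {x | ε ≤ v (x, s)} ∩ K := by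
      ext x
      exact and_comm
    rw [e, ← Measure.restrict_apply' hKm]
    refine measure_mono_ae ?_
    filter_upwards [ae_restrict_of_ae_restrict_of_subset hK hs, ae_restrict_mem hKm]
      with x hx hxK hεx
    have hεu : ε ≤ u x s := hx ▸ hεx
    change ENNReal.ofReal ε ≤ edist (u x s) (u x 0)
    rw [hu0 x (hK hxK), edist_dist, Real.dist_eq, sub_zero]
    exact ENNReal.ofReal_le_ofReal (hεu.trans (le_abs_self _))

/-- If `f s` vanishes almost everywhere in `B` for almost every `s ∈ (0, T')`, then so does `f t` at
every time `t ∈ [0, T']` of continuity with respect to convergence in measure. -/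
lemma ae_eq_zero_of_tendstoInMeasure {α : Type*} [MeasurableSpace α] {μ : Measure α}
    {f : ℝ → α → ℝ} {T' t : ℝ} (hT' : 0 < T') (ht : t ∈ Icc 0 T')
    (hf : ∀ᵐ s ∂(volume.restrict (Ioo 0 T')), ∀ᵐ x ∂μ, f s x = 0)
    (hlim : TendstoInMeasure μ f (𝓝[Icc 0 T'] t) (f t)) : ∀ᵐ x ∂μ, f t x = 0 := by
  have hfreq : ∃ᶠ s in 𝓝[Icc 0 T'] t, ∀ᵐ x ∂μ, f s x = 0 := by
    intro hev
    obtain ⟨O, hO, htO, hOs⟩ := mem_nhdsWithin.1 hev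
    have hne : (O ∩ Ioo 0 T').Nonempty := by
      have : t ∈ closure (Ioo 0 T') := by rwa [closure_Ioo hT'.ne]
      exact mem_closure_iff.1 this O hO htO
    have hpos := (hO.inter isOpen_Ioo).measure_pos volume hne
    rw [ae_restrict_iff' measurableSet_Ioo, ae_iff] at hf
    refine hpos.ne' (measure_mono_null (fun s hs => ?_) hf)
    exact fun hh => hOs ⟨hs.1, Ioo_subset_Icc_self hs.2⟩ (hh hs.2)
  have hnull : ∀ ε : ENNReal, 0 < ε → μ {x | ε ≤ edist 0 (f t x)} = 0 := by
    intro ε hε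
    by_contra hc
    have hev := (hlim ε hε).eventually (gt_mem_nhds (pos_iff_ne_zero.2 hc))
    obtain ⟨s, hs0, hs⟩ := (hfreq.and_eventually hev).exists
    refine absurd hs (not_lt.2 (measure_mono_ae ?_))
    filter_upwards [hs0] with x hx hxε
    change ε ≤ edist (f s x) (f t x)
    rw [hx]
    exact hxε
  have hall : ∀ᵐ x ∂μ, ∀ n : ℕ, ¬ ((n : ENNReal) + 1)⁻¹ ≤ edist 0 (f t x) := by
    rw [ae_all_iff]
    intro n
    rw [ae_iff]
    simpa using hnull ((n : ENNReal) + 1)⁻¹ (by simp)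
  filter_upwards [hall] with x hx
  by_contra hne
  have hpos : edist 0 (f t x) ≠ 0 := fun hh => hne (edist_eq_zero.1 hh).symm
  obtain ⟨n, hn⟩ := ENNReal.exists_inv_nat_lt hpos
  refine hx n (le_trans ?_ hn.le)
  exact ENNReal.inv_le_inv.2 le_self_add

end Einstein

end

theorem theorem1 {N : ℕ} (hN : 1 ≤ N) (h P : ℝ → ℝ) (hP : Einstein.IsCoefficientPair h P)
    (Ω Ω' : Set (EuclideanSpace ℝ (Fin N))) (hΩ : IsOpen Ω) (hΩ' : IsOpen Ω') (hsub : Ω' ⊆ Ω)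
    (T : ℝ) (hT : 0 < T) (u : EuclideanSpace ℝ (Fin N) → ℝ → ℝ)
    (hu : Einstein.IsWeakSolution h P Ω T u)
    (hu0 : ∀ x ∈ Ω', u x 0 = 0)
    (M : ℝ) (hM : 0 < M)
    (huM : ∀ᵐ z ∂(volume.restrict (Ω' ×ˢ Ioo 0 T)), u z.1 z.2 ≤ M)
    (hA1 : Einstein.AssumptionA1 h P M) (hA2 : Einstein.AssumptionA2 h P M)
    (x₀ : EuclideanSpace ℝ (Fin N)) (R : ℝ) (hR : closedBall x₀ R ⊆ Ω')
    (R' : ℝ) (hR' : 0 < R') (hRR' : R' < R) :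
    ∃ T', 0 < T' ∧ T' ≤ T ∧
      (∀ᵐ z ∂(volume.restrict (ball x₀ R' ×ˢ Icc 0 T')), u z.1 z.2 = 0) ∧
      ∀ t ∈ Icc 0 T',
        Einstein.TendstoInLocalMeasure Ω (fun s x => u x s) (𝓝[Icc 0 T'] t) (fun x => u x t) →
        ∀ᵐ x ∂(volume.restrict (ball x₀ R')), u x t = 0 := by
  obtain ⟨v, D, hS, hvu⟩ := hu.exists_isBorelSolution hΩ' hsub hT hM hu0 huM
  obtain ⟨T', hT'0, hT'T, hv⟩ := hS.exists_ae_eq_zero hP hT hA1 hA2 hR hRR'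
  have hball : ball x₀ R' ⊆ Ω' :=
    (ball_subset_closedBall.trans (closedBall_subset_closedBall hRR'.le)).trans hR
  have huv : ∀ᵐ z ∂(volume.restrict (ball x₀ R' ×ˢ Ioo 0 T')), u z.1 z.2 = 0 := by
    filter_upwards [hv, ae_restrict_of_ae_restrict_of_subset
      (prod_mono hball (Ioo_subset_Ioo_right hT'T)) hvu] with z h1 h2
    rw [← h2, h1]
  refine ⟨T', hT'0, hT'T, ?_, ?_⟩
  · have : (ball x₀ R' ×ˢ Icc 0 T' : Set (EuclideanSpace ℝ (Fin N) × ℝ))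
        =ᵐ[volume] ball x₀ R' ×ˢ Ioo 0 T' :=
      Measure.set_prod_ae_eq (ae_eq_refl _) Ioo_ae_eq_Icc.symm
    rwa [Measure.restrict_congr_set this]
  · intro t ht hlim
    have hK := hlim (closedBall x₀ R')
      (((closedBall_subset_closedBall hRR'.le).trans hR).trans hsub) (isCompact_closedBall _ _)
    have hslices : ∀ᵐ s ∂(volume.restrict (Ioo 0 T')),
        ∀ᵐ x ∂(volume.restrict (ball x₀ R')), u x s = 0 := by
      rw [Measure.volume_eq_prod, ← Measure.prod_restrict] at huv
      exact Measure.ae_ae_of_ae_prod (Measure.measurePreserving_swap.quasiMeasurePreserving.ae huv)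
    refine Einstein.ae_eq_zero_of_tendstoInMeasure hT'0 ht hslices fun ε hε => ?_
    exact tendsto_of_tendsto_of_tendsto_of_le_of_le tendsto_const_nhds (hK ε hε)
      (fun _ => zero_le) fun s =>
        Measure.restrict_mono ball_subset_closedBall le_rfl _
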